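/- **Setting.** Let $\mathcal X=\{1,2\}$, let $\mathcal A=\{a_1,\dots,a_m\}$ be a finite nonempty action set, $u(a|x)>0$ a utility, and $D=[0,1]\times[0,\infty)\times[0,1]$ the domain of the psychological parameters $\theta=(\alpha,\lambda,\phi)$. On $\mathbb C^{2}\otimes\mathbb C^{m}$, with basis indexed by pairs $(x,a)$, and for a belief $\eta$ on $\mathcal X$, put $$\mathcal L_{\theta}\rho=-i(1-\alpha)[H,\rho]+\alpha\sum_{k,l}\gamma_{(k,l)}\Big(L_{(k,l)}\rho L_{(k,l)}^\dagger-\tfrac12\{L_{(k,l)}^\dagger L_{(k,l)},\rho\}\Big),\qquad L_{(k,l)}=|k\rangle\langle l|,$$ where $H$ is block diagonal with an all-ones $m\times m$ block for each state, $\gamma_{(k,l)}=[(1-\phi)\Pi^{T}(\lambda)+\phi B^{T}]_{k,l}$, $\Pi(\lambda)_{(x,a),(x',a')}=\mathbf 1_{x=x'}\,u(a'|x)^\lambda/\sum_b u(b|x)^\lambda$ and $B_{(x,a),(x',a')}=\mathbf 1_{a=a'}\,\eta(x')$. For a density operator $\rho_0$ let $\dot\rho_t=\mathcal L_\theta\rho_t$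 and $\Gamma^\eta(a,t)=\operatorname{Tr}(P_a\rho_tP_a^\dagger)$, with $P_a=I\otimes|a\rangle\langle a|$. The steady-state action distribution is $\Gamma^\eta(a)=\lim_{t\to\infty}\Gamma^\eta(a,t)$; it is said to exist at $\theta$ if this limit exists for every initial density operator $\rho_0$ and does not depend on $\rho_0$. Let $p\in[0,1)$, $P=\begin{pmatrix}1&0\\1-p&p\end{pmatrix}$, let $\pi$ be a probability vector on $\mathcal X$ (the public belief), and let $B_{x,y}$ ($x\in\mathcal X$) be probability densities on a measure space $\mathcal Y$. Put $\sigma(\pi,y)=\sum_x B_{x,y}(P'\pi)(x)$, $T(\pi,y)(x)=B_{x,y}(P'\pi)(x)/\sigma(\pi,y)$ when $\sigma(\pi,y)>0$, $\bar\Gamma^\pi_{y,\theta}(a)=\Gamma^{T(\pi,y)}(a)$ and $R^\theta_{x,\pi}(a)=\int_{\mathcal Y}\bar\Gamma^\pi_{y,\theta}(a)B_{x,y}\,dy$. For a probability density $\Lambda$ on $D$ put $\hat R_{x,\pi}(a)=\int_{\mathcal Y}\int_D\bar\Gamma^\pi_{y,\gamma}(a)\Lambda(\gamma)B_{x,y}\,d\gamma\,dy$.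 Write $D(R\|S)=\sum_aR(a)\log(R(a)/S(a))$. **Corollary.** 1. Let $\sigma(\pi,y)>0$. The steady-state action distribution $\bar\Gamma^\pi_{y,\theta}$ exists for all $\theta\in(0,1]\times[0,\infty)\times(0,1)$, and for every $a$ the map $\theta=(\alpha,\lambda,\phi)\mapsto\bar\Gamma^\pi_{y,\theta}(a)$ is continuous on the set of all $\theta\in D$ at which it exists. 2. Let $S_\pi\subseteq D$ be the set of $\theta$ at which $\bar\Gamma^\pi_{y,\theta}$ exists for all $y$ with $\sigma(\pi,y)>0$. Then $(0,1]\times[0,\infty)\times(0,1)\subseteq S_\pi$. Let $x\in\mathcal X$ be such that $\sigma(\pi,y)>0$ for almost every $y$ with $B_{x,y}>0$. Then * for every $a$, $\theta\mapsto R^\theta_{x,\pi}(a)$ is continuous on $S_\pi$, and it is positive there; * $(\theta,\hat\theta)\mapsto D(R^{\theta}_{x,\pi}\|R^{\hat\theta}_{x,\pi})$ is continuous on $S_\pi\times S_\pi$; * for every probability density $\Lambda$ on $D$, $\hat R_{x,\pi}(a)>0$ for all $a$, and $\theta\mapsto D(R^{\theta}_{x,\pi}\|\hat R_{x,\pi})$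 is continuous on $S_\pi$. -/

import Mathlib

open MeasureTheory Filter Topology
open scoped ComplexOrder

noncomputable section

namespace QuantumDecision

/-! ### The Lindbladian decision model

`X` is the finite set of states of nature, `A` the finite set of actions. Operators on
`H_X ⊗ H_A` are complex matrices indexed by `X × A`; `(x, a)` indexes the basis vector
`E_x ⊗ a`. -/

section Model

variable {X A : Type*} [Fintype X] [DecidableEq X] [Fintype A] [DecidableEq A]

/-- Hamiltonian `diag(1_m, …, 1_m)`: one all-ones block, of size the number of actions, for each
state of nature. -/
def hamiltonian (X A : Type*) [DecidableEq X] : Matrix (X × A) (X × A) ℂ :=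
  Matrix.of fun m n => if m.1 = n.1 then 1 else 0

/-- Subjective choice probability `p(a | x) = u(a|x)^lam / ∑_b u(b|x)^lam`. -/
def choiceProb (u : A → X → ℝ) (lam : ℝ) (a : A) (x : X) : ℝ :=
  u a x ^ lam / ∑ b, u b x ^ lam

/-- `Π(lam)`: block diagonal, all rows of the block of `x` are `(p(a | x))_a`. -/
def utilityMatrix (u : A → X → ℝ) (lam : ℝ) : Matrix (X × A) (X × A) ℝ :=
  Matrix.of fun m n => if m.1 = n.1 then choiceProb u lam n.2 n.1 else 0

/-- `B = [η(1) ⋯ η(n)] ⊗ 1 ⊗ I`: the belief matrix. -/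
def beliefMatrix (A : Type*) [DecidableEq A] (η : X → ℝ) : Matrix (X × A) (X × A) ℝ :=
  Matrix.of fun m n => if m.2 = n.2 then η n.1 else 0

/-- Cognitive matrix `C(lam, φ) = (1 - φ) Πᵀ + φ Bᵀ`. -/
def cognitiveMatrix (u : A → X → ℝ) (η : X → ℝ) (lam φ : ℝ) : Matrix (X × A) (X × A) ℝ :=
  (1 - φ) • (utilityMatrix u lam).transpose + φ • (beliefMatrix A η).transpose

/-- Jump operator `|m⟩⟨n|`. -/
def jump (m n : X × A) : Matrix (X × A) (X × A) ℂ := Matrix.single m n 1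

/-- The Lindbladian with parameters `θ = (α, lam, φ)`, utility `u` and belief `η`:
`-i (1-α) [H, ρ] + α ∑_{m,n} γ_{m,n} (L ρ L† - ½ {L† L, ρ})` with `L = |m⟩⟨n|` and
`γ_{m,n} = C(lam, φ)_{m,n}`. -/
def lindbladian (θ : ℝ × ℝ × ℝ) (u : A → X → ℝ) (η : X → ℝ)
    (ρ : Matrix (X × A) (X × A) ℂ) : Matrix (X × A) (X × A) ℂ :=
  (-Complex.I * (1 - (θ.1 : ℂ))) • (hamiltonian X A * ρ - ρ * hamiltonian X A) +
    (θ.1 : ℂ) • ∑ m : X × A, ∑ n : X × A,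
      (cognitiveMatrix u η θ.2.1 θ.2.2 m n : ℂ) •
        (jump m n * ρ * (jump m n).conjTranspose -
          (1 / 2 : ℂ) • ((jump m n).conjTranspose * jump m n * ρ +
            ρ * ((jump m n).conjTranspose * jump m n)))

/-- Density operators: positive semidefinite of trace one. -/
def IsDensity (ρ : Matrix (X × A) (X × A) ℂ) : Prop :=
  ρ.PosSemidef ∧ ρ.trace = 1

/-- `ρ` is an evolution of the psychological state on `[0, ∞)`: it starts in a density operator
and solves `dρ/dt = L ρ` (entrywise). -/
def IsEvolution (θ : ℝ × ℝ × ℝ) (u : A → X → ℝ) (η : X → ℝ)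
    (ρ : ℝ → Matrix (X × A) (X × A) ℂ) : Prop :=
  IsDensity (ρ 0) ∧
    ∀ t, 0 ≤ t → ∀ m n,
      HasDerivWithinAt (fun s => ρ s m n) (lindbladian θ u η (ρ t) m n) (Set.Ici 0) t

/-- Projector `I ⊗ |a⟩⟨a|` onto the subspace of the action `a`. -/
def actionProj (X : Type*) [DecidableEq X] (a : A) : Matrix (X × A) (X × A) ℂ :=
  Matrix.diagonal fun m => if m.2 = a then 1 else 0

/-- Probability `Tr(P_a ρ P_a†)` of the action `a` in the state `ρ`. -/
def actionProb (ρ : Matrix (X × A) (X × A) ℂ) (a : A) : ℝ :=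
  (actionProj X a * ρ * (actionProj X a).conjTranspose).trace.re

/-- `g` is the steady-state action distribution: along every evolution, from whatever initial
density operator, `Γ(a, t) → g a` as `t → ∞`. -/
def IsSteadyAction (θ : ℝ × ℝ × ℝ) (u : A → X → ℝ) (η : X → ℝ) (g : A → ℝ) : Prop :=
  ∀ ρ : ℝ → Matrix (X × A) (X × A) ℂ, IsEvolution θ u η ρ →
    ∀ a, Tendsto (fun t => actionProb (ρ t) a) atTop (𝓝 (g a))

open Classical in
/-- The steady-state action distribution `Γ^η` for the parameters `θ` (zero by convention at
parameters for which there is none). -/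
def steadyAction (θ : ℝ × ℝ × ℝ) (u : A → X → ℝ) (η : X → ℝ) : A → ℝ :=
  if h : ∃ g, IsSteadyAction θ u η g then h.choose else 0

/-- The domain `D = [0,1] × [0,∞) × [0,1]` of the psychological parameters `(α, lam, φ)`. -/
def paramDomain : Set (ℝ × ℝ × ℝ) :=
  Set.Icc 0 1 ×ˢ Set.Ici 0 ×ˢ Set.Icc 0 1

/-- The parameters for which dissipation and both parts of the cognitive matrix are present:
`(0,1] × [0,∞) × (0,1)`. -/
def dissipativeDomain : Set (ℝ × ℝ × ℝ) :=
  Set.Ioc 0 1 ×ˢ Set.Ici 0 ×ˢ Set.Ioo 0 1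

/-- The parameters in `D` for which the steady-state action distribution exists (as a limit
independent of the initial state) under the belief `η`. -/
def steadyParams (u : A → X → ℝ) (η : X → ℝ) : Set (ℝ × ℝ × ℝ) :=
  {θ ∈ paramDomain | ∃ g, IsSteadyAction θ u η g}

end Model

/-! ### Quickest detection with two states of nature

Index `0 : Fin 2` is the state after the change (state 1), index `1 : Fin 2` the state before the
change (state 2). `B x y` is the density of the observation `y` in the state `x`. -/

section Detection

variable {A 𝒴 : Type*} [Fintype A] [DecidableEq A] [MeasurableSpace 𝒴]

/-- Transition matrix of the state of nature. -/
def transition (p : ℝ) : Matrix (Fin 2) (Fin 2) ℝ := !![1, 0; 1 - p, p]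

/-- Normalization `σ(π, y) = 1' B_y P' π`. -/
def predictiveDensity (p : ℝ) (B : Fin 2 → 𝒴 → ℝ) (π : Fin 2 → ℝ) (y : 𝒴) : ℝ :=
  ∑ x, B x y * ((transition p).transpose.mulVec π) x

/-- Bayesian private belief `T(π, y) = B_y P' π / σ(π, y)`. -/
def privateBelief (p : ℝ) (B : Fin 2 → 𝒴 → ℝ) (π : Fin 2 → ℝ) (y : 𝒴) (x : Fin 2) : ℝ :=
  B x y * ((transition p).transpose.mulVec π) x / predictiveDensity p B π y

/-- `Γ̄_y^π(a)` for the psychological parameters `θ`. -/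
def inducedAction (θ : ℝ × ℝ × ℝ) (u : A → Fin 2 → ℝ) (p : ℝ) (B : Fin 2 → 𝒴 → ℝ)
    (π : Fin 2 → ℝ) (y : 𝒴) (a : A) : ℝ :=
  steadyAction θ u (privateBelief p B π y) a

/-- Action likelihood `R_{x,π}(a) = ∫ Γ̄_y^π(a) B_{x,y} dy` for the parameters `θ`. -/
def actionLikelihood (ν : Measure 𝒴) (θ : ℝ × ℝ × ℝ) (u : A → Fin 2 → ℝ) (p : ℝ)
    (B : Fin 2 → 𝒴 → ℝ) (π : Fin 2 → ℝ) (x : Fin 2) (a : A) : ℝ :=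
  ∫ y, inducedAction θ u p B π y a * B x y ∂ν

/-- Action likelihood `R̂_{x,π}(a) = ∫∫ Γ̄_{y,γ}^π(a) Λ(γ) B_{x,y} dγ dy` of a detector whose
estimate of the parameters is the probability density `Λ` on `D`. -/
def estimatedLikelihood (ν : Measure 𝒴) (Λ : ℝ × ℝ × ℝ → ℝ) (u : A → Fin 2 → ℝ) (p : ℝ)
    (B : Fin 2 → 𝒴 → ℝ) (π : Fin 2 → ℝ) (x : Fin 2) (a : A) : ℝ :=
  ∫ y, (∫ γ in paramDomain, inducedAction γ u p B π y a * Λ γ) * B x y ∂ν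

/-- Kullback-Leibler divergence `∑_a R(a) log (R(a) / S(a))`. -/
def klDivergence (R S : A → ℝ) : ℝ := ∑ a, R a * Real.log (R a / S a)

/-- The parameters in `D` for which the steady-state action distribution exists at every
observation at which the private belief is defined. -/
def detectionParams (u : A → Fin 2 → ℝ) (p : ℝ) (B : Fin 2 → 𝒴 → ℝ) (π : Fin 2 → ℝ) :
    Set (ℝ × ℝ × ℝ) :=
  {θ ∈ paramDomain | ∀ y, 0 < predictiveDensity p B π y →
    θ ∈ steadyParams u (privateBelief p B π y)}

end Detection

end QuantumDecision

end

namespace QuantumDecision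

set_option linter.unusedSectionVars false

section Model

variable {X A : Type*} [Fintype X] [DecidableEq X] [Fintype A] [DecidableEq A]

/-! ### The cognitive matrix -/

section Cognitive

variable {u : A → X → ℝ} {η : X → ℝ} {lam φ : ℝ}

/-! The columns of the cognitive matrix `C` sum to one, so the generator collapses to `-i(1-α)[H,ρ]
+ α(diag(C diag ρ) - ρ)` (`lindbladian_eq`). Everything rests on this form.

Stationary density operators exist on all of `D` (`exists_isStationary`). For `α ≠ 0`, stationarity
says that `ρ` is a fixed point of `diag(C diag ·)` followed by a resolvent of the commutator with
`H`. That composite is a linear self-map of the compact convex set of density operators. For `α =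
0`, the belief times the uniform distribution on the actions is stationary.

On the dissipative domain, the weights of the states of nature relax at rate `αφ`. The partial trace
over the states obeys a closed equation forced by these weights and damped at rate `α(1-φ)`; its
diagonal holds the action probabilities. A Lyapunov function then gives convergence to the action
probabilities of any stationary state (`IsStationary.tendsto_actionProb`).

Continuity needs neither a formula nor uniqueness of the stationary operator. A stationary operator
is a constant evolution, so wherever the steady action distribution exists, every stationary
operator computes it. By compactness, stationary operators accumulate only at stationary operators
of the limiting parameters (`continuousOn_steadyAction`). Stationarity also forces every action
probability to be positive (`steadyAction_pos`). Dominated convergence carries continuity to the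
likelihoods, an average of values in `(0,1]` against a probability density stays in `(0,1]`, and so
the divergences are finite sums of continuous terms. -/

lemma sum_rpow_pos [Nonempty A] (hu : ∀ a x, 0 < u a x) (lam : ℝ) (x : X) :
    0 < ∑ b, u b x ^ lam :=
  Finset.sum_pos (fun b _ => Real.rpow_pos_of_pos (hu b x) _) Finset.univ_nonempty

lemma choiceProb_pos [Nonempty A] (hu : ∀ a x, 0 < u a x) (lam : ℝ) (a : A) (x : X) :
    0 < choiceProb u lam a x :=
  div_pos (Real.rpow_pos_of_pos (hu a x) _) (sum_rpow_pos hu lam x)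

lemma sum_choiceProb [Nonempty A] (hu : ∀ a x, 0 < u a x) (lam : ℝ) (x : X) :
    ∑ a, choiceProb u lam a x = 1 := by
  simp only [choiceProb, ← Finset.sum_div]
  exact div_self (sum_rpow_pos hu lam x).ne'

lemma cognitiveMatrix_apply (u : A → X → ℝ) (η : X → ℝ) (lam φ : ℝ) (m n : X × A) :
    cognitiveMatrix u η lam φ m n =
      (1 - φ) * (if n.1 = m.1 then choiceProb u lam m.2 m.1 else 0) +
        φ * (if n.2 = m.2 then η m.1 else 0) := by
  simp only [cognitiveMatrix, utilityMatrix, beliefMatrix, Matrix.add_apply, Matrix.smul_apply,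
    Matrix.transpose_apply, Matrix.of_apply, smul_eq_mul]

lemma cognitiveMatrix_nonneg [Nonempty A] (hu : ∀ a x, 0 < u a x) (hη : ∀ x, 0 ≤ η x)
    (hφ : φ ∈ Set.Icc (0 : ℝ) 1) (m n : X × A) : 0 ≤ cognitiveMatrix u η lam φ m n := by
  rw [cognitiveMatrix_apply]
  have h1 := hφ.1
  have h2 : 0 ≤ 1 - φ := by linarith [hφ.2]
  have h3 := (choiceProb_pos hu lam m.2 m.1).le
  have h4 := hη m.1
  split_ifs <;> positivity

lemma sum_cognitiveMatrix [Nonempty A] (hu : ∀ a x, 0 < u a x) (hη : ∑ x, η x = 1)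
    (n : X × A) : ∑ m, cognitiveMatrix u η lam φ m n = 1 := by
  simp only [cognitiveMatrix_apply, Finset.sum_add_distrib, ← Finset.mul_sum]
  rw [Fintype.sum_prod_type, Fintype.sum_prod_type]
  have h1 : ∑ x, ∑ a, (if n.1 = x then choiceProb u lam a x else 0) = 1 := by
    rw [Finset.sum_comm]
    simp [sum_choiceProb hu]
  have h2 : ∑ x, ∑ a, (if n.2 = a then η x else 0) = 1 := by simp [hη]
  simp only [h1, h2]
  ring

/-- The cognitive matrix acting on the diagonal of an operator. -/
noncomputable def cognitiveDiag (u : A → X → ℝ) (η : X → ℝ) (lam φ : ℝ) (ρ : Matrix (X × A) (X × A) ℂ)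
    (m : X × A) : ℂ :=
  ∑ n, (cognitiveMatrix u η lam φ m n : ℂ) * ρ n n

lemma sum_cognitiveDiag [Nonempty A] (hu : ∀ a x, 0 < u a x) (hη : ∑ x, η x = 1)
    (ρ : Matrix (X × A) (X × A) ℂ) : ∑ m, cognitiveDiag u η lam φ ρ m = ρ.trace := by
  simp only [cognitiveDiag]
  rw [Finset.sum_comm]
  refine Finset.sum_congr rfl fun n _ => ?_
  rw [← Finset.sum_mul, ← Complex.ofReal_sum, sum_cognitiveMatrix hu hη]
  simp

lemma cognitiveDiag_apply (u : A → X → ℝ) (η : X → ℝ) (lam φ : ℝ)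
    (ρ : Matrix (X × A) (X × A) ℂ) (m : X × A) :
    cognitiveDiag u η lam φ ρ m =
      (1 - φ) * choiceProb u lam m.2 m.1 * ∑ b, ρ (m.1, b) (m.1, b) +
        φ * η m.1 * ∑ x, ρ (x, m.2) (x, m.2) := by
  simp only [cognitiveDiag, cognitiveMatrix_apply, Complex.ofReal_add, Complex.ofReal_mul, add_mul,
    Finset.sum_add_distrib, Fintype.sum_prod_type, Complex.ofReal_sub, Complex.ofReal_one]
  congr 1
  · rw [Finset.sum_comm]
    simp [Finset.mul_sum, apply_ite Complex.ofReal, ite_mul, mul_ite]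
  · simp [Finset.mul_sum, apply_ite Complex.ofReal, ite_mul, mul_ite]

/-- As the columns of the cognitive matrix sum to one, the dissipator replaces the state by the
image of its diagonal under the cognitive matrix. -/
lemma lindbladian_eq [Nonempty A] (hu : ∀ a x, 0 < u a x) (hη : ∑ x, η x = 1)
    (θ : ℝ × ℝ × ℝ) (ρ : Matrix (X × A) (X × A) ℂ) :
    lindbladian θ u η ρ =
      (-Complex.I * (1 - (θ.1 : ℂ))) • (hamiltonian X A * ρ - ρ * hamiltonian X A) +
        (θ.1 : ℂ) • (Matrix.diagonal (cognitiveDiag u η θ.2.1 θ.2.2 ρ) - ρ) := by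
  unfold lindbladian
  congr 2
  simp only [jump, Matrix.conjTranspose_single, star_one, Matrix.single_mul_mul_single, one_mul,
    mul_one, Matrix.single_mul_single_same, smul_sub, Finset.sum_sub_distrib]
  congr 1
  · ext i j
    simp only [Matrix.sum_apply, Matrix.smul_apply, Matrix.single_apply, Matrix.diagonal_apply,
      cognitiveDiag]
    by_cases h : i = j
    · subst h
      simp
    · have h' : ∀ x, ¬ (x = i ∧ x = j) := fun x hx => h (hx.1.symm.trans hx.2)
      simp [h, h']
  -- Here `L†L = |n⟩⟨n|`. Summing over `m` first turns the rates into column sums equal to one, and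
  -- `∑ |n⟩⟨n| = 1` leaves `ρ` itself.
  · rw [Finset.sum_comm]
    simp only [← Finset.sum_smul, ← Complex.ofReal_sum, sum_cognitiveMatrix hu hη,
      Complex.ofReal_one, one_smul]
    rw [← Finset.smul_sum, Finset.sum_add_distrib, ← Finset.sum_mul, ← Finset.mul_sum,
      Matrix.sum_single_one]
    ext i j
    simp
    ring

lemma hamiltonian_mul_apply (ρ : Matrix (X × A) (X × A) ℂ) (m n : X × A) :
    (hamiltonian X A * ρ) m n = ∑ c, ρ (m.1, c) n := by
  simp only [hamiltonian, Matrix.mul_apply, Matrix.of_apply, Fintype.sum_prod_type, ite_mul,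
    one_mul, zero_mul]
  rw [Finset.sum_comm]
  simp

lemma mul_hamiltonian_apply (ρ : Matrix (X × A) (X × A) ℂ) (m n : X × A) :
    (ρ * hamiltonian X A) m n = ∑ c, ρ m (n.1, c) := by
  simp only [hamiltonian, Matrix.mul_apply, Matrix.of_apply, Fintype.sum_prod_type, mul_ite,
    mul_one, mul_zero]
  rw [Finset.sum_comm]
  simp

lemma lindbladian_apply [Nonempty A] (hu : ∀ a x, 0 < u a x) (hη : ∑ x, η x = 1)
    (θ : ℝ × ℝ × ℝ) (ρ : Matrix (X × A) (X × A) ℂ) (m n : X × A) :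
    lindbladian θ u η ρ m n =
      (-Complex.I * (1 - (θ.1 : ℂ))) * (∑ c, ρ (m.1, c) n - ∑ c, ρ m (n.1, c)) +
        (θ.1 : ℂ) * ((if m = n then cognitiveDiag u η θ.2.1 θ.2.2 ρ m else 0) - ρ m n) := by
  rw [lindbladian_eq hu hη]
  simp only [Matrix.add_apply, Matrix.smul_apply, Matrix.sub_apply, hamiltonian_mul_apply,
    mul_hamiltonian_apply, Matrix.diagonal_apply, smul_eq_mul]

end Cognitive

/-! ### Density operators -/

section Density

variable {n : Type*} [Fintype n] [DecidableEq n]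

/-- The principal minor on the indices `i, j` is nonnegative. Hence a vanishing diagonal entry kills
its whole row and column. -/
lemma posSemidef_normSq_apply_le {ρ : Matrix n n ℂ} (h : ρ.PosSemidef) (i j : n) :
    Complex.normSq (ρ i j) ≤ (ρ i i).re * (ρ j j).re := by
  have h1 := (h.submatrix ![i, j]).det_nonneg
  rw [Matrix.det_fin_two] at h1
  have h2 : ρ j i = star (ρ i j) := (h.isHermitian.apply j i).symm
  have hi := Complex.le_def.1 (h.diag_nonneg (i := i))
  have hj := Complex.le_def.1 (h.diag_nonneg (i := j))
  have h3 := (Complex.le_def.1 h1).1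
  simp [h2] at h3 hi hj
  rw [Complex.normSq_apply]
  nlinarith [hi.2, hj.2]

lemma IsDensity.diag_re_nonneg {ρ : Matrix (X × A) (X × A) ℂ} (h : IsDensity ρ) (m : X × A) :
    0 ≤ (ρ m m).re := (Complex.le_def.1 (h.1.diag_nonneg (i := m))).1

lemma IsDensity.sum_re {ρ : Matrix (X × A) (X × A) ℂ} (h : IsDensity ρ) :
    ∑ m, (ρ m m).re = 1 := by
  rw [← Complex.re_sum]
  have := congrArg Complex.re h.2
  simpa [Matrix.trace] using this

lemma IsDensity.diag_re_le_one {ρ : Matrix (X × A) (X × A) ℂ} (h : IsDensity ρ) (m : X × A) :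
    (ρ m m).re ≤ 1 :=
  h.sum_re ▸ Finset.single_le_sum (f := fun m => (ρ m m).re)
    (fun i _ => h.diag_re_nonneg i) (Finset.mem_univ m)

lemma IsDensity.norm_apply_le {ρ : Matrix (X × A) (X × A) ℂ} (h : IsDensity ρ) (m n : X × A) :
    ‖ρ m n‖ ≤ 1 := by
  have h1 := posSemidef_normSq_apply_le h.1 m n
  rw [Complex.normSq_eq_norm_sq] at h1
  have h2 := mul_le_mul (h.diag_re_le_one m) (h.diag_re_le_one n) (h.diag_re_nonneg n) zero_le_one
  nlinarith [norm_nonneg (ρ m n)]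

lemma isCompact_setOf_isDensity :
    IsCompact {ρ : Matrix (X × A) (X × A) ℂ | IsDensity ρ} := by
  let K : Set (Matrix (X × A) (X × A) ℂ) :=
    Set.univ.pi fun _ => Set.univ.pi fun _ => Metric.closedBall 0 1
  have hc : IsCompact K :=
    isCompact_univ_pi fun _ => isCompact_univ_pi fun _ => isCompact_closedBall _ _
  refine hc.of_isClosed_subset ?_ fun ρ h => ?_
  · have : {ρ : Matrix (X × A) (X × A) ℂ | IsDensity ρ} =
        ({ρ | ρ.conjTranspose = ρ} ∩ ⋂ v : X × A → ℂ, {ρ | 0 ≤ star v ⬝ᵥ (ρ.mulVec v)}) ∩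
          {ρ | ρ.trace = 1} := by
      ext ρ
      simp [IsDensity, Matrix.posSemidef_iff_dotProduct_mulVec, Matrix.IsHermitian]
    rw [this]
    refine IsClosed.inter (IsClosed.inter ?_ (isClosed_iInter fun v => ?_)) ?_
    · exact isClosed_eq (by fun_prop) continuous_id
    · exact isClosed_le continuous_const (by fun_prop)
    · exact isClosed_eq (by fun_prop) continuous_const
  · exact fun i _ j _ => mem_closedBall_zero_iff.2 (IsDensity.norm_apply_le h i j)

lemma actionProb_eq (ρ : Matrix (X × A) (X × A) ℂ) (a : A) :
    actionProb ρ a = ∑ x, (ρ (x, a) (x, a)).re := by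
  simp only [actionProb, actionProj, Matrix.diagonal_conjTranspose, Matrix.trace, Matrix.diag,
    Matrix.mul_diagonal, Matrix.diagonal_mul, Complex.re_sum, Fintype.sum_prod_type]
  refine Finset.sum_congr rfl fun x _ => ?_
  rw [Finset.sum_eq_single a]
  · simp
  · intro b _ hb
    simp [hb]
  · simp

lemma IsDensity.actionProb_nonneg {ρ : Matrix (X × A) (X × A) ℂ} (h : IsDensity ρ) (a : A) :
    0 ≤ actionProb ρ a := by
  rw [actionProb_eq]
  exact Finset.sum_nonneg fun x _ => h.diag_re_nonneg _

lemma IsDensity.sum_actionProb {ρ : Matrix (X × A) (X × A) ℂ} (h : IsDensity ρ) :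
    ∑ a, actionProb ρ a = 1 := by
  simp only [actionProb_eq]
  rw [← h.sum_re, Fintype.sum_prod_type, Finset.sum_comm]

lemma IsDensity.actionProb_le_one {ρ : Matrix (X × A) (X × A) ℂ} (h : IsDensity ρ) (a : A) :
    actionProb ρ a ≤ 1 :=
  h.sum_actionProb ▸ Finset.single_le_sum (f := actionProb ρ)
    (fun i _ => h.actionProb_nonneg i) (Finset.mem_univ a)

end Density

end Model

/-! ### Existence of stationary density operators -/

/-- A linear self-map of a nonempty compact convex set has a fixed point. -/
lemma exists_fixedPoint_of_isCompact_convex {E : Type*} [NormedAddCommGroup E] [NormedSpace ℝ E]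
    {T : E →ₗ[ℝ] E} (hT : Continuous T) {K : Set E} (hK : IsCompact K) (hKc : Convex ℝ K)
    (hne : K.Nonempty) (hm : Set.MapsTo T K K) : ∃ x ∈ K, T x = x := by
  obtain ⟨x₀, hx₀⟩ := hne
  have horb : ∀ k, T^[k] x₀ ∈ K := fun k => hm.iterate k hx₀
  -- The shift to `n + 1` matters: the average of zero terms is `0`, which may lie outside `K`.
  have hs : ∀ n, birkhoffAverage ℝ T id (n + 1) x₀ ∈ K := fun n => by
    rw [birkhoffAverage, birkhoffSum, Finset.smul_sum]
    refine hKc.sum_mem (fun i _ => by positivity) ?_ fun i _ => horb i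
    simp
    field_simp
  obtain ⟨x, hx, φ, hφ, hlim⟩ := hK.tendsto_subseq hs
  refine ⟨x, hx, ?_⟩
  have hb : Bornology.IsBounded (Set.range fun k => id (T^[k] x₀)) :=
    hK.isBounded.subset (Set.range_subset_iff.2 horb)
  have h0 := tendsto_birkhoffAverage_apply_sub_birkhoffAverage ℝ hb
  have h1 : ∀ n, birkhoffAverage ℝ T id n (T x₀) = T (birkhoffAverage ℝ T id n x₀) := fun n => by
    simp [birkhoffAverage, birkhoffSum, ← Function.iterate_succ_apply,
      Function.iterate_succ_apply']
  simp only [h1] at h0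
  have h2 := h0.comp ((tendsto_add_atTop_nat 1).comp hφ.tendsto_atTop)
  have h3 := ((hT.tendsto x).comp hlim).sub hlim
  exact sub_eq_zero.1 (tendsto_nhds_unique h3 h2)

/-! ### Resolvent of the commutator with a projection -/

section Relaxation

variable {n : Type*} [Fintype n] [DecidableEq n]

/-- For a projection `P`, multiplies the off-diagonal blocks of `Q` with respect to `P` and
`1 - P` by `star w` and `w`. -/
def damp (P : Matrix n n ℂ) (w : ℂ) (Q : Matrix n n ℂ) : Matrix n n ℂ :=
  P * Q * P + (1 - P) * Q * (1 - P) + star w • (P * Q * (1 - P)) + w • ((1 - P) * Q * P)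

/-- The commutator with `P` acts as `+1` on the block `P Q (1 - P)`, as `-1` on `(1 - P) Q P`, and
as `0` on the diagonal blocks. So `damp P w` inverts `Q ↦ Q + b[P, Q]` block by block. -/
lemma damp_add_commutator {P : Matrix n n ℂ} (hP : P * P = P) {b w : ℂ}
    (hw : w * (1 - b) = 1) (hw' : star w * (1 + b) = 1) (Q : Matrix n n ℂ) :
    damp P w Q + b • (P * damp P w Q - damp P w Q * P) = Q := by
  obtain ⟨R, hR⟩ : ∃ R, R = 1 - P := ⟨_, rfl⟩
  have hPR : P * R = 0 := by simp [hR, mul_sub, hP]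
  have hRP : R * P = 0 := by simp [hR, sub_mul, hP]
  have hRR : R * R = R := by rw [hR, mul_sub, ← hR, hRP]; simp
  have hPP' : ∀ M, P * (P * M) = P * M := fun M => by rw [← mul_assoc, hP]
  have hPR' : ∀ M, P * (R * M) = 0 := fun M => by rw [← mul_assoc, hPR, zero_mul]
  have hQ : Q = P * (Q * P) + R * (Q * R) + P * (Q * R) + R * (Q * P) := by
    have h1 : P + R = 1 := by rw [hR]; abel
    calc Q = (P + R) * (Q * (P + R)) := by rw [h1]; simp
      _ = _ := by rw [add_mul, mul_add, mul_add, mul_add]; abel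
  have h1 : damp P w Q = P * (Q * P) + R * (Q * R) + star w • (P * (Q * R)) +
      w • (R * (Q * P)) := by
    simp only [damp, ← hR, mul_assoc]
  have h2 : P * damp P w Q - damp P w Q * P = star w • (P * (Q * R)) - w • (R * (Q * P)) := by
    rw [h1]
    simp only [mul_add, add_mul, mul_smul_comm, smul_mul_assoc, mul_assoc, hPP', hPR', hP, hRP,
      mul_zero, smul_zero, add_zero]
    abel
  rw [h2, h1]
  conv_rhs => rw [hQ]
  have h3 : P * (Q * R) = (star w * (1 + b)) • (P * (Q * R)) := by rw [hw', one_smul]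
  have h4 : R * (Q * P) = (w * (1 - b)) • (R * (Q * P)) := by rw [hw, one_smul]
  conv_rhs => rw [h3, h4]
  module

lemma trace_damp {P : Matrix n n ℂ} (hP : P * P = P) (w : ℂ) (Q : Matrix n n ℂ) :
    (damp P w Q).trace = Q.trace := by
  have h1 : (1 - P) * (1 - P) = 1 - P := by
    simp [mul_sub, sub_mul, hP]
  have h2 : (1 - P) * P = 0 := by simp [sub_mul, hP]
  have h3 : P * (1 - P) = 0 := by simp [mul_sub, hP]
  simp only [damp, Matrix.trace_add, Matrix.trace_smul]
  rw [Matrix.trace_mul_cycle, hP, Matrix.trace_mul_cycle (1 - P), h1, Matrix.trace_mul_cycle P,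
    h2, Matrix.trace_mul_cycle (1 - P), h3, ← Matrix.trace_add, ← Matrix.add_mul]
  simp

/-- With `R = 1 - P`, the damped operator is `(P + wR) Q (P + wR)†` plus `(1 - ‖w‖²) R Q R`, and
both terms are positive semidefinite. -/
lemma posSemidef_damp {P : Matrix n n ℂ} (hP' : P.conjTranspose = P) {w : ℂ}
    (hw : ‖w‖ ≤ 1) {Q : Matrix n n ℂ} (hQ : Q.PosSemidef) : (damp P w Q).PosSemidef := by
  have hR : (1 - P).conjTranspose = 1 - P := by simp [hP']
  have h1 := hQ.mul_mul_conjTranspose_same (P + w • (1 - P))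
  have h2 := (hQ.mul_mul_conjTranspose_same (1 - P)).smul
    (a := 1 - ‖w‖ ^ 2) (by nlinarith [norm_nonneg w])
  have h3 : w * star w = ((‖w‖ ^ 2 : ℝ) : ℂ) := by
    rw [Complex.ofReal_pow]; exact Complex.mul_conj' w
  convert h1.add h2 using 1
  rw [Matrix.conjTranspose_add, Matrix.conjTranspose_smul, hR, hP', damp]
  have h4 : (1 - ‖w‖ ^ 2) • ((1 - P) * Q * (1 - P)) =
      (1 - w * star w) • ((1 - P) * Q * (1 - P)) := by
    rw [h3]
    ext i j
    simp
  rw [h4]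
  simp only [add_mul, mul_add, smul_mul_assoc, mul_smul_comm]
  module

lemma damp_add (P : Matrix n n ℂ) (w : ℂ) (Q Q' : Matrix n n ℂ) :
    damp P w (Q + Q') = damp P w Q + damp P w Q' := by
  simp only [damp, add_mul, mul_add, smul_add]
  abel

lemma damp_smul (P : Matrix n n ℂ) (w : ℂ) (c : ℝ) (Q : Matrix n n ℂ) :
    damp P w (c • Q) = c • damp P w Q := by
  simp only [damp, smul_mul_assoc, mul_smul_comm, smul_add, smul_comm c]

end Relaxation

/-! ### Stationary density operators as fixed points -/

section Stationary

variable {X A : Type*} [Fintype X] [DecidableEq X] [Fintype A] [DecidableEq A]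
variable {u : A → X → ℝ} {η : X → ℝ} {θ : ℝ × ℝ × ℝ}

/-- The stationary density operators. -/
def IsStationary (θ : ℝ × ℝ × ℝ) (u : A → X → ℝ) (η : X → ℝ)
    (ρ : Matrix (X × A) (X × A) ℂ) : Prop :=
  IsDensity ρ ∧ lindbladian θ u η ρ = 0

lemma convex_setOf_isDensity : Convex ℝ {ρ : Matrix (X × A) (X × A) ℂ | IsDensity ρ} := by
  intro ρ hρ σ hσ a b ha hb hab
  refine ⟨(hρ.1.smul ha).add (hσ.1.smul hb), ?_⟩
  rw [Matrix.trace_add, Matrix.trace_smul, Matrix.trace_smul, hρ.2, hσ.2, ← add_smul, hab,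
    one_smul]

lemma isDensity_diagonal {q : X × A → ℂ} (h0 : ∀ m, 0 ≤ q m) (h1 : ∑ m, q m = 1) :
    IsDensity (Matrix.diagonal q) :=
  ⟨Matrix.PosSemidef.diagonal h0, by rw [Matrix.trace_diagonal, h1]⟩

/-- The product of a belief with the uniform distribution on the actions. -/
lemma isDensity_diagonal_uniform [Nonempty A] (hη : η ∈ stdSimplex ℝ X) :
    IsDensity (Matrix.diagonal fun m : X × A => ((η m.1 / Fintype.card A : ℝ) : ℂ)) := by
  refine isDensity_diagonal (fun m => ?_) ?_
  · exact Complex.zero_le_real.2 (div_nonneg (hη.1 _) (Nat.cast_nonneg _))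
  · rw [← Complex.ofReal_sum, Fintype.sum_prod_type]
    simp only [Finset.sum_const, Finset.card_univ, nsmul_eq_mul]
    have : (Fintype.card A : ℝ) ≠ 0 := Nat.cast_ne_zero.2 Fintype.card_ne_zero
    simp [mul_div_cancel₀, this, hη.2]

lemma isStationary_uniform [Nonempty A] (hu : ∀ a x, 0 < u a x) (hη : η ∈ stdSimplex ℝ X)
    (h : θ.1 = 0 ∨ θ.2.2 = 1) :
    IsStationary θ u η (Matrix.diagonal fun m : X × A => ((η m.1 / Fintype.card A : ℝ) : ℂ)) := by
  refine ⟨isDensity_diagonal_uniform hη, ?_⟩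
  have hη1 : ∑ x, (η x : ℂ) = 1 := by rw [← Complex.ofReal_sum, hη.2, Complex.ofReal_one]
  ext m n
  rw [lindbladian_apply hu hη.2]
  have h1 : ∑ c, (Matrix.diagonal fun m : X × A => ((η m.1 / Fintype.card A : ℝ) : ℂ)) (m.1, c) n =
      ∑ c, (Matrix.diagonal fun m : X × A => ((η m.1 / Fintype.card A : ℝ) : ℂ)) m (n.1, c) := by
    obtain ⟨x, a⟩ := m
    obtain ⟨y, b⟩ := n
    by_cases hxy : x = y
    · subst hxy
      simp [Matrix.diagonal_apply]
    · simp [hxy]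
  rw [h1, sub_self, mul_zero, zero_add]
  rcases h with h | h
  · simp [h]
  · by_cases hmn : m = n
    · subst hmn
      rw [cognitiveDiag_apply, h]
      simp [← Finset.sum_mul, hη1, div_eq_mul_inv]
    · simp [hmn]

lemma hamiltonian_mul_self :
    hamiltonian X A * hamiltonian X A = (Fintype.card A : ℂ) • hamiltonian X A := by
  ext m n
  rw [hamiltonian_mul_apply]
  by_cases h : m.1 = n.1 <;> simp [hamiltonian, h]

lemma conjTranspose_hamiltonian : (hamiltonian X A).conjTranspose = hamiltonian X A := by
  ext m n
  simp [hamiltonian, apply_ite star, eq_comm]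

lemma cognitiveDiag_nonneg [Nonempty A] (hu : ∀ a x, 0 < u a x) (hη : ∀ x, 0 ≤ η x)
    {lam φ : ℝ} (hφ : φ ∈ Set.Icc (0 : ℝ) 1) {ρ : Matrix (X × A) (X × A) ℂ} (hρ : IsDensity ρ)
    (m : X × A) : 0 ≤ cognitiveDiag u η lam φ ρ m :=
  Finset.sum_nonneg fun n _ => mul_nonneg
    (Complex.zero_le_real.2 (cognitiveMatrix_nonneg hu hη hφ m n)) hρ.1.diag_nonneg

attribute [local instance] Matrix.normedAddCommGroup Matrix.normedSpace in
lemma exists_isStationary [Nonempty A] (hu : ∀ a x, 0 < u a x) (hη : η ∈ stdSimplex ℝ X)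
    (hθ : θ ∈ paramDomain) : ∃ ρ, IsStationary θ u η ρ := by
  rcases eq_or_ne θ.1 0 with h0 | h0
  · exact ⟨_, isStationary_uniform hu hη (Or.inl h0)⟩
  obtain ⟨c, hc⟩ : ∃ c : ℂ, c = Fintype.card A := ⟨_, rfl⟩
  have hc0 : c ≠ 0 := hc ▸ Nat.cast_ne_zero.2 Fintype.card_ne_zero
  let P : Matrix (X × A) (X × A) ℂ := c⁻¹ • hamiltonian X A
  have hHP : hamiltonian X A = c • P := by simp [P, smul_smul, hc0]
  have hP : P * P = P := by
    simp only [P, smul_mul_assoc, mul_smul_comm, hamiltonian_mul_self, ← hc, smul_smul]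
    rw [inv_mul_cancel₀ hc0, mul_one]
  have hP' : P.conjTranspose = P := by
    simp [P, conjTranspose_hamiltonian, hc]
  -- With `H = cP`, dividing the stationarity equation by `α` gives `ρ + b[P, ρ] = diag(C diag ρ)`
  -- for `b = ir`. As `b` is imaginary, `1 ± b` have real part one, so they are invertible and `‖w‖
  -- ≤ 1`.
  obtain ⟨r, hr⟩ : ∃ r : ℝ, r = (1 - θ.1) * Fintype.card A / θ.1 := ⟨_, rfl⟩
  let b : ℂ := Complex.I * r
  have hb1 : 1 - b ≠ 0 := fun h => by simpa [b] using congrArg Complex.re h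
  have hb2 : 1 + b ≠ 0 := fun h => by simpa [b] using congrArg Complex.re h
  let w : ℂ := (1 - b)⁻¹
  have hw : w * (1 - b) = 1 := inv_mul_cancel₀ hb1
  have hw' : star w * (1 + b) = 1 := by
    have : star w = (1 + b)⁻¹ := by simp [w, b]
    rw [this, inv_mul_cancel₀ hb2]
  have hwn : ‖w‖ ≤ 1 := by
    rw [norm_inv]
    refine inv_le_one_of_one_le₀ ?_
    simpa [b] using Complex.abs_re_le_norm (1 - b)
  let T : Matrix (X × A) (X × A) ℂ →ₗ[ℝ] Matrix (X × A) (X × A) ℂ :=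
    { toFun := fun ρ => damp P w (Matrix.diagonal (cognitiveDiag u η θ.2.1 θ.2.2 ρ))
      map_add' := fun ρ σ => by
        rw [← damp_add, Matrix.diagonal_add]
        congr 2
        ext m
        simp [cognitiveDiag, mul_add, Finset.sum_add_distrib]
      map_smul' := fun a ρ => by
        rw [RingHom.id_apply, ← damp_smul, ← Matrix.diagonal_smul]
        congr 2
        ext m
        simp [cognitiveDiag, Finset.mul_sum, mul_left_comm] }
  have hT : Continuous T := T.continuous_of_finiteDimensional
  obtain ⟨ρ, hρ, hfix⟩ := exists_fixedPoint_of_isCompact_convex hT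
    (isCompact_setOf_isDensity (X := X) (A := A)) convex_setOf_isDensity
    ⟨_, isDensity_diagonal_uniform hη⟩ (fun ρ hρ => by
      have hd := isDensity_diagonal (cognitiveDiag_nonneg (lam := θ.2.1) hu hη.1 hθ.2.2 hρ)
        (by rw [sum_cognitiveDiag hu hη.2, hρ.2])
      exact ⟨posSemidef_damp hP' hwn hd.1, (trace_damp hP w _).trans hd.2⟩)
  refine ⟨ρ, hρ, ?_⟩
  have hfix' : damp P w (Matrix.diagonal (cognitiveDiag u η θ.2.1 θ.2.2 ρ)) = ρ := hfix
  have key := damp_add_commutator hP hw hw'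
    (Matrix.diagonal (cognitiveDiag u η θ.2.1 θ.2.2 ρ))
  rw [hfix'] at key
  rw [lindbladian_eq hu hη.2, ← key, hHP]
  have h0' : (θ.1 : ℂ) ≠ 0 := Complex.ofReal_ne_zero.2 h0
  have hbc : (θ.1 : ℂ) * b = Complex.I * (1 - θ.1) * c := by
    simp only [b, hr, hc]
    push_cast
    field_simp
  simp only [smul_mul_assoc, mul_smul_comm, add_sub_cancel_left, ← smul_sub, smul_smul, hbc]
  module

end Stationary

/-! ### Convergence to the steady state -/

/-- Grönwall: `V t * exp (r t)` is antitone. -/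
lemma tendsto_zero_of_deriv_le {V V' : ℝ → ℝ} {r : ℝ} (hr : 0 < r)
    (hd : ∀ t, 0 ≤ t → HasDerivWithinAt V (V' t) (Set.Ici 0) t) (h0 : ∀ t, 0 ≤ V t)
    (hle : ∀ t, 0 ≤ t → V' t ≤ -r * V t) : Tendsto V atTop (𝓝 0) := by
  have hW : ∀ t, 0 ≤ t → HasDerivWithinAt (fun t => V t * Real.exp (r * t))
      (V' t * Real.exp (r * t) + V t * (Real.exp (r * t) * (r * 1))) (Set.Ici 0) t :=
    fun t ht => (hd t ht).mul (((hasDerivAt_id t).const_mul r).exp.hasDerivWithinAt)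
  have hanti : AntitoneOn (fun t => V t * Real.exp (r * t)) (Set.Ici 0) := by
    refine antitoneOn_of_deriv_nonpos (convex_Ici 0)
      (fun t ht => (hW t ht).continuousWithinAt) ?_ ?_
    · intro t ht
      rw [interior_Ici] at ht
      exact ((hW t ht.le).hasDerivAt (Ici_mem_nhds ht)).differentiableAt.differentiableWithinAt
    · intro t ht
      rw [interior_Ici] at ht
      rw [((hW t ht.le).hasDerivAt (Ici_mem_nhds ht)).deriv]
      have := mul_le_mul_of_nonneg_right (hle t ht.le) (Real.exp_pos (r * t)).le
      linarith
  have hbound : ∀ t, 0 ≤ t → V t ≤ V 0 * Real.exp (-(r * t)) := fun t ht => by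
    have := hanti Set.self_mem_Ici ht ht
    simp only [mul_zero, Real.exp_zero, mul_one] at this
    rw [Real.exp_neg, ← div_eq_mul_inv]
    exact (le_div_iff₀ (Real.exp_pos _)).2 this
  have hlim : Tendsto (fun t => V 0 * Real.exp (-(r * t))) atTop (𝓝 0) := by
    simpa using (Real.tendsto_exp_neg_atTop_nhds_zero.comp
      (tendsto_id.const_mul_atTop hr)).const_mul (V 0)
  exact tendsto_of_tendsto_of_tendsto_of_le_of_le' tendsto_const_nhds hlim
    (Eventually.of_forall h0) ((eventually_ge_atTop 0).mono hbound)

/-! ### Lyapunov estimate for the partial trace over the states of nature -/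

section Reduced

variable {A : Type*} [Fintype A] [DecidableEq A]

/-- The commutator with the all-ones matrix does not change the Hilbert–Schmidt norm. -/
lemma re_sum_conj_mul_commutator (κ : ℝ) (E : A → A → ℂ) :
    (∑ a, ∑ b, star (E a b) * (-Complex.I * κ * (∑ c, E c b - ∑ c, E a c))).re = 0 := by
  have h1 : ∑ a, ∑ b, star (E a b) * ∑ c, E c b =
      ((∑ b, Complex.normSq (∑ a, E a b) : ℝ) : ℂ) := by
    rw [Finset.sum_comm, Complex.ofReal_sum]
    refine Finset.sum_congr rfl fun b _ => ?_
    rw [← Finset.sum_mul, ← star_sum]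
    exact (Complex.normSq_eq_conj_mul_self).symm
  have h2 : ∑ a, ∑ b, star (E a b) * ∑ c, E a c =
      ((∑ a, Complex.normSq (∑ b, E a b) : ℝ) : ℂ) := by
    rw [Complex.ofReal_sum]
    refine Finset.sum_congr rfl fun b _ => ?_
    rw [← Finset.sum_mul, ← star_sum]
    exact (Complex.normSq_eq_conj_mul_self).symm
  have h3 : ∑ a, ∑ b, star (E a b) * (-Complex.I * κ * (∑ c, E c b - ∑ c, E a c)) =
      -Complex.I * κ * (∑ a, ∑ b, star (E a b) * ∑ c, E c b -
        ∑ a, ∑ b, star (E a b) * ∑ c, E a c) := by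
    simp only [← Finset.sum_sub_distrib, Finset.mul_sum (s := (Finset.univ : Finset A))
      (a := -Complex.I * (κ : ℂ))]
    refine Finset.sum_congr rfl fun a _ => Finset.sum_congr rfl fun b _ => ?_
    rw [← Finset.mul_sum, Finset.sum_sub_distrib]
    ring
  rw [h3, h1, h2]
  simp

/-- The commutator leaves the norm of `E` unchanged. The term `-αE` beats the diagonal gain `αφE`
with margin `s = α(1 - φ)`, and the forcing `f` decays by itself at rate `c`. -/
lemma tendsto_zero_of_reduced_equation {α φ κ c : ℝ} (hα : 0 < α) (hφ0 : 0 ≤ φ) (hφ : φ < 1)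
    (hc : 0 < c) {E : ℝ → A → A → ℂ} {f : ℝ → A → ℂ}
    (hE : ∀ t, 0 ≤ t → ∀ a b, HasDerivWithinAt (fun s => E s a b)
      (-Complex.I * κ * (∑ c, E t c b - ∑ c, E t a c) +
        ((if a = b then α * φ * E t a a + f t a else 0) - α * E t a b)) (Set.Ici 0) t)
    (hf : ∀ t, 0 ≤ t → ∀ a, HasDerivWithinAt (fun s => f s a) (-c * f t a) (Set.Ici 0) t)
    (a b : A) : Tendsto (fun t => E t a b) atTop (𝓝 0) := by
  let s : ℝ := α * (1 - φ)
  have hs : 0 < s := mul_pos hα (by linarith)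
  -- With the weight `(cs)⁻¹`, the decay of `f` contributes `-2s⁻¹‖f‖²`: half absorbs the cross term
  -- in Young's inequality, half remains. The result is `V' ≤ -min(s, c) V`.
  let V : ℝ → ℝ := fun t => ∑ a, ∑ b, ‖E t a b‖ ^ 2 + (c * s)⁻¹ * ∑ a, ‖f t a‖ ^ 2
  have hV : ∀ t, 0 ≤ t → HasDerivWithinAt V
      (∑ a, ∑ b, 2 * inner ℝ (E t a b) (-Complex.I * κ * (∑ c, E t c b - ∑ c, E t a c) +
        ((if a = b then α * φ * E t a a + f t a else 0) - α * E t a b)) +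
        (c * s)⁻¹ * ∑ a, 2 * inner ℝ (f t a) (-c * f t a)) (Set.Ici 0) t := fun t ht =>
    (HasDerivWithinAt.fun_sum fun a _ => HasDerivWithinAt.fun_sum fun b _ =>
      (hE t ht a b).norm_sq).add
      ((HasDerivWithinAt.fun_sum fun a _ => (hf t ht a).norm_sq).const_mul _)
  have hV0 : ∀ t, 0 ≤ V t := fun t => by
    have := (mul_pos hc hs).le
    positivity
  have hlim : Tendsto V atTop (𝓝 0) := by
    refine tendsto_zero_of_deriv_le (lt_min hs hc) hV hV0 fun t _ => ?_
    have hinner : ∀ z w : ℂ, inner ℝ z w = (star z * w).re := fun z w => by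
      rw [Complex.inner, mul_comm]; rfl
    have h1 : ∑ a, ∑ b, 2 * inner ℝ (E t a b) (-Complex.I * κ * (∑ c, E t c b - ∑ c, E t a c) +
        ((if a = b then α * φ * E t a a + f t a else 0) - α * E t a b)) =
        2 * ∑ a, (α * φ * ‖E t a a‖ ^ 2 + inner ℝ (E t a a) (f t a)) -
          2 * α * ∑ a, ∑ b, ‖E t a b‖ ^ 2 := by
      have h2 : ∀ a b, 2 * inner ℝ (E t a b) (-Complex.I * κ * (∑ c, E t c b - ∑ c, E t a c) +
          ((if a = b then α * φ * E t a a + f t a else 0) - α * E t a b)) =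
          2 * (star (E t a b) * (-Complex.I * κ * (∑ c, E t c b - ∑ c, E t a c))).re +
            2 * (if a = b then α * φ * ‖E t a a‖ ^ 2 + inner ℝ (E t a a) (f t a) else 0) -
            2 * α * ‖E t a b‖ ^ 2 := fun a b => by
        have h3 : inner ℝ (E t a b) ((α : ℂ) * E t a b) = α * ‖E t a b‖ ^ 2 := by
          rw [← Complex.real_smul, inner_smul_right, real_inner_self_eq_norm_sq]
        rw [inner_add_right, inner_sub_right, h3, ← hinner]
        split_ifs with hab
        · subst hab
          have h4 : inner ℝ (E t a a) ((α : ℂ) * φ * E t a a) = α * φ * ‖E t a a‖ ^ 2 := by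
            rw [← Complex.ofReal_mul, ← Complex.real_smul, inner_smul_right,
              real_inner_self_eq_norm_sq]
          rw [inner_add_right, h4]
          ring
        · rw [inner_zero_right]
          ring
      simp only [h2, Finset.sum_sub_distrib, Finset.sum_add_distrib, ← Finset.mul_sum]
      have h5 := re_sum_conj_mul_commutator κ (E t)
      simp only [Complex.re_sum] at h5
      rw [h5]
      simp [Finset.sum_add_distrib, Finset.mul_sum]
    have h6 : ∀ a, inner ℝ (f t a) (-c * f t a) = -c * ‖f t a‖ ^ 2 := fun a => by
      rw [← Complex.ofReal_neg, ← Complex.real_smul, inner_smul_right, real_inner_self_eq_norm_sq]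
    have h7 : ∀ a, 2 * inner ℝ (E t a a) (f t a) ≤ s * ‖E t a a‖ ^ 2 + s⁻¹ * ‖f t a‖ ^ 2 :=
      fun a => by
        have h8 := real_inner_le_norm (E t a a) (f t a)
        have h9 : 0 ≤ s⁻¹ * (s * ‖E t a a‖ - ‖f t a‖) ^ 2 := by positivity
        have h10 : s⁻¹ * (s * ‖E t a a‖ - ‖f t a‖) ^ 2 =
            s * ‖E t a a‖ ^ 2 + s⁻¹ * ‖f t a‖ ^ 2 - 2 * (‖E t a a‖ * ‖f t a‖) := by
          field_simp
          ring
        linarith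
    have h11 : ∑ a, ‖E t a a‖ ^ 2 ≤ ∑ a, ∑ b, ‖E t a b‖ ^ 2 :=
      Finset.sum_le_sum fun a _ => Finset.single_le_sum (f := fun b => ‖E t a b‖ ^ 2)
        (fun b _ => by positivity) (Finset.mem_univ a)
    have h12 := Finset.sum_le_sum fun a (_ : a ∈ Finset.univ) => h7 a
    rw [h1]
    simp only [h6, Finset.sum_add_distrib, ← Finset.mul_sum] at h12 ⊢
    have hF : 0 ≤ ∑ a, ‖f t a‖ ^ 2 := by positivity
    have hN : 0 ≤ ∑ a, ∑ b, ‖E t a b‖ ^ 2 := by positivity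
    simp only [V]
    generalize ∑ a, ‖f t a‖ ^ 2 = F at *
    generalize ∑ a, ∑ b, ‖E t a b‖ ^ 2 = N at *
    generalize ∑ a, ‖E t a a‖ ^ 2 = M at *
    generalize ∑ a, inner ℝ (E t a a) (f t a) = J at *
    have h13 : (c * s)⁻¹ * (2 * (-c * F)) = -(2 * (s⁻¹ * F)) := by
      field_simp
    have h14 : c * ((c * s)⁻¹ * F) = s⁻¹ * F := by
      field_simp
    have h15 : min s c * N ≤ s * N := mul_le_mul_of_nonneg_right (min_le_left _ _) hN
    have h16 : min s c * ((c * s)⁻¹ * F) ≤ c * ((c * s)⁻¹ * F) :=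
      mul_le_mul_of_nonneg_right (min_le_right _ _) (by positivity)
    have h17 : (2 * (α * φ) + s) * M ≤ (2 * (α * φ) + s) * N :=
      mul_le_mul_of_nonneg_left h11 (by positivity)
    have h18 : (2 * (α * φ) + s) * N = 2 * α * N - s * N := by
      simp only [s]; ring
    rw [h13]
    linarith
  have hle : ∀ t, ‖E t a b‖ ^ 2 ≤ V t := fun t => by
    have h1 := Finset.single_le_sum (f := fun b => ‖E t a b‖ ^ 2)
      (fun b _ => by positivity) (Finset.mem_univ b)
    have h2 := Finset.single_le_sum (f := fun a => ∑ b, ‖E t a b‖ ^ 2)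
      (fun b _ => by positivity) (Finset.mem_univ a)
    have h3 : 0 ≤ (c * s)⁻¹ * ∑ a, ‖f t a‖ ^ 2 := by positivity
    simp only [V]
    linarith
  have hsq : Tendsto (fun t => ‖E t a b‖ ^ 2) atTop (𝓝 0) :=
    tendsto_of_tendsto_of_tendsto_of_le_of_le tendsto_const_nhds hlim
      (fun t => by positivity) hle
  rw [tendsto_zero_iff_norm_tendsto_zero]
  have := hsq.sqrt
  simpa [Real.sqrt_sq] using this

end Reduced

/-! ### Relaxation of the action probabilities on the dissipative domain -/

section Convergence

variable {X A : Type*} [Fintype X] [DecidableEq X] [Fintype A] [DecidableEq A] [Nonempty A]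
variable {u : A → X → ℝ} {η : X → ℝ} {θ : ℝ × ℝ × ℝ}

lemma lindbladian_sub (hu : ∀ a x, 0 < u a x) (hη : ∑ x, η x = 1) (θ : ℝ × ℝ × ℝ)
    (ρ σ : Matrix (X × A) (X × A) ℂ) :
    lindbladian θ u η (ρ - σ) = lindbladian θ u η ρ - lindbladian θ u η σ := by
  have h : cognitiveDiag u η θ.2.1 θ.2.2 (ρ - σ) =
      cognitiveDiag u η θ.2.1 θ.2.2 ρ - cognitiveDiag u η θ.2.1 θ.2.2 σ := by
    ext m
    simp [cognitiveDiag, mul_sub]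
  have hd : Matrix.diagonal (cognitiveDiag u η θ.2.1 θ.2.2 ρ - cognitiveDiag u η θ.2.1 θ.2.2 σ) =
      Matrix.diagonal (cognitiveDiag u η θ.2.1 θ.2.2 ρ) -
        Matrix.diagonal (cognitiveDiag u η θ.2.1 θ.2.2 σ) := (Matrix.diagonal_sub _ _).symm
  simp only [lindbladian_eq hu hη, h, hd, mul_sub, sub_mul]
  module

/-- The weights of the states of nature evolve independently of the actions. -/
lemma sum_action_lindbladian (hu : ∀ a x, 0 < u a x) (hη : ∑ x, η x = 1)
    (ρ : Matrix (X × A) (X × A) ℂ) (x : X) :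
    ∑ a, lindbladian θ u η ρ (x, a) (x, a) =
      θ.1 * θ.2.2 * (η x * ρ.trace - ∑ a, ρ (x, a) (x, a)) := by
  have hp : ∑ a, (choiceProb u θ.2.1 a x : ℂ) = 1 := by
    rw [← Complex.ofReal_sum, sum_choiceProb hu, Complex.ofReal_one]
  have ht : ρ.trace = ∑ a, ∑ y, ρ (y, a) (y, a) := by
    rw [Finset.sum_comm, Matrix.trace, Fintype.sum_prod_type]
    rfl
  simp only [lindbladian_apply hu hη, if_true, cognitiveDiag_apply, Finset.sum_add_distrib,
    ← Finset.mul_sum, Finset.sum_sub_distrib, ← Finset.sum_mul, hp, ht]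
  -- The commutator has zero trace on each block, so only the dissipator contributes.
  rw [Finset.sum_comm, sub_self]
  ring

/-- Evolution of the partial trace over the states of nature. -/
lemma sum_state_lindbladian (hu : ∀ a x, 0 < u a x) (hη : ∑ x, η x = 1)
    (ρ : Matrix (X × A) (X × A) ℂ) (a b : A) :
    ∑ x, lindbladian θ u η ρ (x, a) (x, b) =
      -Complex.I * ((1 - θ.1 : ℝ) : ℂ) *
          (∑ c, ∑ x, ρ (x, c) (x, b) - ∑ c, ∑ x, ρ (x, a) (x, c)) +
        ((if a = b then θ.1 * θ.2.2 * ∑ x, ρ (x, a) (x, a) +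
          ∑ x, θ.1 * (1 - θ.2.2) * choiceProb u θ.2.1 a x * ∑ c, ρ (x, c) (x, c) else 0) -
          θ.1 * ∑ x, ρ (x, a) (x, b)) := by
  have hη1 : ∑ x, (η x : ℂ) = 1 := by rw [← Complex.ofReal_sum, hη, Complex.ofReal_one]
  simp only [lindbladian_apply hu hη, Finset.sum_add_distrib, ← Finset.mul_sum,
    Finset.sum_sub_distrib, Prod.mk.injEq, true_and]
  rw [Finset.sum_comm, Finset.sum_comm (f := fun x c => ρ (x, a) (x, c)), Complex.ofReal_sub,
    Complex.ofReal_one]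
  congr 1
  split_ifs with h
  · simp only [cognitiveDiag_apply, Finset.sum_add_distrib, ← Finset.sum_mul, ← Finset.mul_sum, hη1]
    simp only [mul_assoc, ← Finset.mul_sum]
    ring
  · simp

lemma IsStationary.tendsto_actionProb (hu : ∀ a x, 0 < u a x) (hη : ∑ x, η x = 1)
    (hθ : θ ∈ dissipativeDomain) {σ : Matrix (X × A) (X × A) ℂ} (hσ : IsStationary θ u η σ)
    {ρ : ℝ → Matrix (X × A) (X × A) ℂ} (hρ : IsEvolution θ u η ρ) (a : A) :
    Tendsto (fun t => actionProb (ρ t) a) atTop (𝓝 (actionProb σ a)) := by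
  obtain ⟨⟨hα, -⟩, -, hφ0, hφ1⟩ := hθ
  have hd : ∀ t, 0 ≤ t → ∀ m n, HasDerivWithinAt (fun s => (ρ s - σ) m n)
      (lindbladian θ u η (ρ t - σ) m n) (Set.Ici 0) t := fun t ht m n => by
    rw [lindbladian_sub hu hη, hσ.2, sub_zero]
    exact (hρ.2 t ht m n).sub_const _
  -- The trace is conserved and both operators start with trace one, so the source term `η x *
  -- trace` disappears from the equation for the state weights of the difference.
  have htr : ∀ t, 0 ≤ t → (ρ t - σ).trace = 0 := by
    have hd' : ∀ t, 0 ≤ t → HasDerivWithinAt (fun s => (ρ s - σ).trace) 0 (Set.Ici 0) t := by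
      intro t ht
      have h1 : HasDerivWithinAt (fun s => ∑ m, (ρ s - σ) m m)
          (∑ m, lindbladian θ u η (ρ t - σ) m m) (Set.Ici 0) t :=
        HasDerivWithinAt.fun_sum fun m _ => hd t ht m m
      have hη1 : ∑ x, (η x : ℂ) = 1 := by rw [← Complex.ofReal_sum, hη, Complex.ofReal_one]
      have h2 : ∑ m, lindbladian θ u η (ρ t - σ) m m = 0 := by
        have ht : (ρ t - σ).trace = ∑ x, ∑ a, (ρ t - σ) (x, a) (x, a) := by
          rw [Matrix.trace, Fintype.sum_prod_type]
          rfl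
        rw [Fintype.sum_prod_type]
        simp only [sum_action_lindbladian hu hη, ← Finset.mul_sum, Finset.sum_sub_distrib,
          ← Finset.sum_mul, hη1]
        rw [ht]
        ring
      rw [h2] at h1
      exact h1
    intro t ht
    have h1 := constant_of_has_deriv_right_zero (a := 0) (b := t)
      (fun s hs => (hd' s hs.1).continuousWithinAt.mono Set.Icc_subset_Ici_self)
      (fun s hs => (hd' s hs.1).mono (Set.Ici_subset_Ici.2 hs.1)) t ⟨ht, le_rfl⟩
    rw [h1, Matrix.trace_sub, hρ.1.2, hσ.1.2, sub_self]
  have hτ : ∀ t, 0 ≤ t → ∀ x, HasDerivWithinAt (fun s => ∑ a, (ρ s - σ) (x, a) (x, a))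
      (-((θ.1 * θ.2.2 : ℝ) : ℂ) * ∑ a, (ρ t - σ) (x, a) (x, a)) (Set.Ici 0) t := by
    intro t ht x
    have h1 : HasDerivWithinAt (fun s => ∑ a, (ρ s - σ) (x, a) (x, a))
        (∑ a, lindbladian θ u η (ρ t - σ) (x, a) (x, a)) (Set.Ici 0) t :=
      HasDerivWithinAt.fun_sum fun a _ => hd t ht (x, a) (x, a)
    rw [sum_action_lindbladian hu hη, htr t ht] at h1
    convert h1 using 1
    push_cast
    ring
  have hlim := tendsto_zero_of_reduced_equation (κ := 1 - θ.1) (c := θ.1 * θ.2.2) hα hφ0.le hφ1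
    (mul_pos hα hφ0) (E := fun t a b => ∑ x, (ρ t - σ) (x, a) (x, b))
    (f := fun t a => ∑ x, θ.1 * (1 - θ.2.2) * choiceProb u θ.2.1 a x *
      ∑ c, (ρ t - σ) (x, c) (x, c))
    (fun t ht a b => by
      rw [← sum_state_lindbladian hu hη]
      exact HasDerivWithinAt.fun_sum fun x _ => hd t ht (x, a) (x, b))
    (fun t ht a => by
      have h1 : HasDerivWithinAt (fun s => ∑ x, (θ.1 : ℂ) * (1 - θ.2.2) * choiceProb u θ.2.1 a x *
          ∑ c, (ρ s - σ) (x, c) (x, c)) (∑ x, (θ.1 : ℂ) * (1 - θ.2.2) * choiceProb u θ.2.1 a x *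
          (-((θ.1 * θ.2.2 : ℝ) : ℂ) * ∑ c, (ρ t - σ) (x, c) (x, c))) (Set.Ici 0) t :=
        HasDerivWithinAt.fun_sum fun x _ => (hτ t ht x).const_mul _
      convert h1 using 1
      rw [Finset.mul_sum]
      refine Finset.sum_congr rfl fun x _ => ?_
      ring) a a
  have h1 := ((Complex.continuous_re.tendsto 0).comp hlim).add_const (actionProb σ a)
  refine (h1.congr fun t => ?_).trans (by simp)
  simp [actionProb_eq]

end Convergence

/-! ### The steady-state action distribution -/

section Steady

variable {X A : Type*} [Fintype X] [DecidableEq X] [Fintype A] [DecidableEq A]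
variable {u : A → X → ℝ} {η : X → ℝ} {θ : ℝ × ℝ × ℝ}

lemma IsStationary.isEvolution {ρ : Matrix (X × A) (X × A) ℂ} (h : IsStationary θ u η ρ) :
    IsEvolution θ u η fun _ => ρ :=
  ⟨h.1, fun t _ m n => by
    rw [h.2]
    exact hasDerivWithinAt_const _ _ _⟩

lemma isSteadyAction_steadyAction (h : ∃ g, IsSteadyAction θ u η g) :
    IsSteadyAction θ u η (steadyAction θ u η) := by
  rw [steadyAction, dif_pos h]
  exact h.choose_spec

/-- A stationary operator is a constant evolution, so the common limit must be its own action
distribution. -/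
lemma IsStationary.steadyAction_eq {ρ : Matrix (X × A) (X × A) ℂ} (hρ : IsStationary θ u η ρ)
    (h : θ ∈ steadyParams u η) (a : A) : steadyAction θ u η a = actionProb ρ a :=
  tendsto_nhds_unique (isSteadyAction_steadyAction h.2 _ hρ.isEvolution a) tendsto_const_nhds

lemma dissipativeDomain_subset_paramDomain : dissipativeDomain ⊆ paramDomain :=
  Set.prod_mono Set.Ioc_subset_Icc_self (Set.prod_mono subset_rfl Set.Ioo_subset_Icc_self)

lemma continuous_cognitiveMatrix [Nonempty A] (hu : ∀ a x, 0 < u a x) (m n : X × A) :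
    Continuous fun q : (ℝ × ℝ × ℝ) × (X → ℝ) =>
      cognitiveMatrix u q.2 q.1.2.1 q.1.2.2 m n := by
  have h1 : ∀ a x, Continuous fun l : ℝ => u a x ^ l := fun a x =>
    Real.continuous_const_rpow (hu a x).ne'
  have h2 : ∀ a x, Continuous fun l : ℝ => choiceProb u l a x := fun a x =>
    (h1 a x).div (continuous_finsetSum _ fun b _ => h1 b x) fun l => (sum_rpow_pos hu l x).ne'
  simp only [cognitiveMatrix_apply]
  have h3 := (h2 m.2 m.1).comp
    (show Continuous fun q : (ℝ × ℝ × ℝ) × (X → ℝ) => q.1.2.1 by fun_prop)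
  simp only [Function.comp_def] at h3
  split_ifs <;> fun_prop

lemma continuous_lindbladian [Nonempty A] (hu : ∀ a x, 0 < u a x) :
    Continuous fun q : ((ℝ × ℝ × ℝ) × (X → ℝ)) × Matrix (X × A) (X × A) ℂ =>
      lindbladian q.1.1 u q.1.2 q.2 := by
  unfold lindbladian
  have h1 : Continuous fun q : ((ℝ × ℝ × ℝ) × (X → ℝ)) × Matrix (X × A) (X × A) ℂ =>
      (q.1.1.1 : ℂ) := by fun_prop
  have h2 : ∀ m n, Continuous fun q : ((ℝ × ℝ × ℝ) × (X → ℝ)) × Matrix (X × A) (X × A) ℂ =>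
      (cognitiveMatrix u q.1.2 q.1.1.2.1 q.1.1.2.2 m n : ℂ) := fun m n =>
    Complex.continuous_ofReal.comp ((continuous_cognitiveMatrix hu m n).comp continuous_fst)
  fun_prop

lemma continuous_actionProb (a : A) :
    Continuous fun ρ : Matrix (X × A) (X × A) ℂ => actionProb ρ a := by
  unfold actionProb
  fun_prop

variable [Nonempty A]

lemma dissipativeDomain_subset_steadyParams (hu : ∀ a x, 0 < u a x)
    (hη : η ∈ stdSimplex ℝ X) : dissipativeDomain ⊆ steadyParams u η := by
  intro θ hθ
  have hD := dissipativeDomain_subset_paramDomain hθ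
  obtain ⟨σ, hσ⟩ := exists_isStationary hu hη hD
  exact ⟨hD, actionProb σ, fun ρ hρ a => hσ.tendsto_actionProb hu hη.2 hθ hρ a⟩

/-- The steady-state action distribution depends continuously on the parameters and the belief,
wherever it exists: limits of stationary density operators are stationary. -/
lemma continuousOn_steadyAction (hu : ∀ a x, 0 < u a x) (a : A) :
    ContinuousOn (fun q : (ℝ × ℝ × ℝ) × (X → ℝ) => steadyAction q.1 u q.2 a)
      {q | q.2 ∈ stdSimplex ℝ X ∧ q.1 ∈ steadyParams u q.2} := by
  intro q₀ hq₀
  have hex : ∀ q : (ℝ × ℝ × ℝ) × (X → ℝ), ∃ ρ : Matrix (X × A) (X × A) ℂ,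
      q.2 ∈ stdSimplex ℝ X ∧ q.1 ∈ steadyParams u q.2 → IsStationary q.1 u q.2 ρ := fun q => by
    by_cases h : q.2 ∈ stdSimplex ℝ X ∧ q.1 ∈ steadyParams u q.2
    · obtain ⟨ρ, hρ⟩ := exists_isStationary hu h.1 h.2.1
      exact ⟨ρ, fun _ => hρ⟩
    · exact ⟨0, fun h' => absurd h' h⟩
  choose ρ hρ using hex
  -- Along an ultrafilter the chosen stationary operators converge by compactness, although the
  -- choice need not be continuous in the parameters.
  rw [ContinuousWithinAt, tendsto_iff_ultrafilter]
  intro 𝒰 h𝒰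
  have hS : ∀ᶠ q in (𝒰 : Filter ((ℝ × ℝ × ℝ) × (X → ℝ))), q.2 ∈ stdSimplex ℝ X ∧ q.1 ∈ steadyParams u q.2 :=
    h𝒰 self_mem_nhdsWithin
  have hq : Tendsto id (𝒰 : Filter _) (𝓝 q₀) := h𝒰.trans nhdsWithin_le_nhds
  obtain ⟨σ, hσ, hlim⟩ := (isCompact_setOf_isDensity (X := X) (A := A)).ultrafilter_le_nhds
    (𝒰.map ρ) (le_principal_iff.2 (hS.mono fun q h => (hρ q h).1))
  have hlim' : Tendsto ρ 𝒰 (𝓝 σ) := hlim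
  have hL := ((continuous_lindbladian (A := A) hu).tendsto (q₀, σ)).comp
    (hq.prodMk_nhds hlim')
  have hL0 : lindbladian q₀.1 u q₀.2 σ = 0 :=
    tendsto_nhds_unique hL (tendsto_const_nhds.congr' (hS.mono fun q h => (hρ q h).2.symm))
  have hst : IsStationary q₀.1 u q₀.2 σ := ⟨hσ, hL0⟩
  have h1 := ((continuous_actionProb a).tendsto σ).comp hlim'
  rw [← hst.steadyAction_eq hq₀.2] at h1
  exact h1.congr' (hS.mono fun q h => ((hρ q h).steadyAction_eq h.2 a).symm)

lemma steadyAction_le_one (hu : ∀ a x, 0 < u a x) (hη : η ∈ stdSimplex ℝ X)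
    (h : θ ∈ steadyParams u η) (a : A) : steadyAction θ u η a ≤ 1 := by
  obtain ⟨ρ, hρ⟩ := exists_isStationary hu hη h.1
  rw [hρ.steadyAction_eq h]
  exact hρ.1.actionProb_le_one a

/-- If the action `a` had probability zero, the rows and columns `(x, a)` would vanish, and
stationarity would force zero inflow there. But the inflow from each `(x, c)` has rate at least `(1
- φ) p(a|x) > 0`, so the whole diagonal would vanish, contradicting trace one. -/
lemma IsStationary.actionProb_pos (hu : ∀ a x, 0 < u a x) (hη : η ∈ stdSimplex ℝ X)
    (hθ : θ ∈ paramDomain) (hα : θ.1 ≠ 0) (hφ : θ.2.2 ≠ 1) {ρ : Matrix (X × A) (X × A) ℂ}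
    (hρ : IsStationary θ u η ρ) (a : A) : 0 < actionProb ρ a := by
  refine (hρ.1.actionProb_nonneg a).lt_of_ne' fun h0 => ?_
  rw [actionProb_eq, Finset.sum_eq_zero_iff_of_nonneg fun x _ => hρ.1.diag_re_nonneg _] at h0
  have hz : ∀ x n, ρ (x, a) n = 0 := fun x n => by
    have h1 := posSemidef_normSq_apply_le hρ.1.1 (x, a) n
    rw [h0 x (Finset.mem_univ x), zero_mul] at h1
    exact Complex.normSq_eq_zero.1 (h1.antisymm (Complex.normSq_nonneg _))
  have hz' : ∀ x n, ρ n (x, a) = 0 := fun x n => by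
    rw [← hρ.1.1.isHermitian.apply, hz, star_zero]
  have hC : ∀ x, cognitiveDiag u η θ.2.1 θ.2.2 ρ (x, a) = 0 := fun x => by
    have h1 : lindbladian θ u η ρ (x, a) (x, a) = 0 := by rw [hρ.2]; rfl
    rw [lindbladian_apply hu hη.2] at h1
    simpa [hz, hz', hα] using h1
  have hd : ∀ m, (ρ m m).re = 0 := by
    rintro ⟨x, c⟩
    have h1 : ∑ n, cognitiveMatrix u η θ.2.1 θ.2.2 (x, a) n * (ρ n n).re = 0 := by
      have := congrArg Complex.re (hC x)
      simpa [cognitiveDiag] using this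
    have h2 := cognitiveMatrix_nonneg (lam := θ.2.1) hu hη.1 hθ.2.2
    have h3 := (Finset.sum_eq_zero_iff_of_nonneg fun n _ =>
      mul_nonneg (h2 _ n) (hρ.1.diag_re_nonneg n)).1 h1 (x, c) (Finset.mem_univ _)
    refine (mul_eq_zero.1 h3).resolve_left (ne_of_gt ?_)
    rw [cognitiveMatrix_apply, if_pos rfl]
    have h4 : 0 < 1 - θ.2.2 := sub_pos.2 (hθ.2.2.2.lt_of_ne hφ)
    have h5 := choiceProb_pos hu θ.2.1 a x
    have h6 := hη.1 x
    have h7 := hθ.2.2.1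
    split_ifs <;> positivity
  have h1 := hρ.1.sum_re
  simp [hd] at h1

lemma steadyAction_pos (hu : ∀ a x, 0 < u a x) (hη : η ∈ stdSimplex ℝ X)
    (h : θ ∈ steadyParams u η) (a : A) : 0 < steadyAction θ u η a := by
  -- In these degenerate cases the uniform choice of action is stationary and gives every action
  -- probability `1 / m`.
  by_cases h1 : θ.1 = 0 ∨ θ.2.2 = 1
  · rw [(isStationary_uniform hu hη h1).steadyAction_eq h, actionProb_eq]
    simp [← Finset.sum_div, hη.2, Fintype.card_pos]
  · obtain ⟨ρ, hρ⟩ := exists_isStationary hu hη h.1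
    rw [hρ.steadyAction_eq h]
    exact hρ.actionProb_pos hu hη h.1 (fun h' => h1 (Or.inl h')) (fun h' => h1 (Or.inr h')) a

end Steady

/-! ### Averages against a probability density -/

section Average

variable {Y : Type*} [MeasurableSpace Y] {ν : Measure Y} {b h : Y → ℝ} {U : Set Y}

lemma aemeasurable_restrict_of_continuousOn_comp {E : Type*} [TopologicalSpace E]
    [MeasurableSpace E] [BorelSpace E] {f : Y → E} {g : E → ℝ} {s : Set E}
    (hf : Measurable f) (hU : MeasurableSet U) (hg : ContinuousOn g s) (hm : Set.MapsTo f U s) :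
    AEMeasurable (fun y => g (f y)) (ν.restrict U) := by
  refine aemeasurable_restrict_of_measurable_subtype hU ?_
  have h1 : Measurable fun y : U => (⟨f y, hm y.2⟩ : s) :=
    (hf.comp measurable_subtype_coe).subtype_mk
  exact hg.domRestrict.measurable.comp h1

lemma aestronglyMeasurable_mul_density (hb : Integrable b ν) (hb0 : 0 ≤ᵐ[ν] b)
    (hU : MeasurableSet U) (hbU : ∀ᵐ y ∂ν, 0 < b y → y ∈ U) (hm : AEMeasurable h (ν.restrict U)) :
    AEStronglyMeasurable (fun y => h y * b y) ν := by
  have h1 : AEStronglyMeasurable (fun y => U.indicator h y * b y) ν :=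
    ((aemeasurable_indicator_iff hU).2 hm).aestronglyMeasurable.mul hb.1
  refine h1.congr ?_
  filter_upwards [hb0, hbU] with y hy0 hyU
  rcases hy0.eq_or_lt with h0 | h0
  · simp [← h0]
  · rw [Set.indicator_of_mem (hyU h0)]

lemma norm_mul_density_le (hb0 : 0 ≤ᵐ[ν] b) (hbU : ∀ᵐ y ∂ν, 0 < b y → y ∈ U)
    (h0 : ∀ y ∈ U, 0 < h y) (h1 : ∀ y ∈ U, h y ≤ 1) : ∀ᵐ y ∂ν, ‖h y * b y‖ ≤ b y := by
  filter_upwards [hb0, hbU] with y hy0 hyU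
  rcases hy0.eq_or_lt with hz | hz
  · simp [← hz]
  · rw [norm_mul, Real.norm_of_nonneg (h0 y (hyU hz)).le, Real.norm_of_nonneg hy0]
    exact mul_le_of_le_one_left hy0 (h1 y (hyU hz))

/-- Serves both the average over observations and the average over parameter estimates; values of
`h` off `U` are irrelevant because `b` vanishes there almost everywhere. -/
lemma integral_mul_density_pos_le_one (hb0 : 0 ≤ᵐ[ν] b) (hb1 : ∫ y, b y ∂ν = 1)
    (hU : MeasurableSet U) (hbU : ∀ᵐ y ∂ν, 0 < b y → y ∈ U) (hm : AEMeasurable h (ν.restrict U))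
    (h0 : ∀ y ∈ U, 0 < h y) (h1 : ∀ y ∈ U, h y ≤ 1) :
    0 < ∫ y, h y * b y ∂ν ∧ ∫ y, h y * b y ∂ν ≤ 1 := by
  have hb : Integrable b ν := by
    by_contra hb
    rw [integral_undef hb] at hb1
    exact zero_ne_one hb1
  have hle := norm_mul_density_le hb0 hbU h0 h1
  have hi : Integrable (fun y => h y * b y) ν :=
    hb.mono' (aestronglyMeasurable_mul_density hb hb0 hU hbU hm) hle
  have hnn : 0 ≤ᵐ[ν] fun y => h y * b y := by
    filter_upwards [hb0, hbU] with y hy0 hyU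
    rcases hy0.eq_or_lt with hz | hz
    · simp [← hz]
    · exact mul_nonneg (h0 y (hyU hz)).le hy0
  constructor
  · rw [integral_pos_iff_support_of_nonneg_ae hnn hi]
    have hpos : 0 < ν (Function.support b) :=
      (integral_pos_iff_support_of_nonneg_ae hb0 hb).1 (hb1 ▸ one_pos)
    refine hpos.trans_le (measure_mono_ae ?_)
    filter_upwards [hb0, hbU] with y hy0 hyU hy
    have hz := hy0.lt_of_ne' hy
    exact (mul_pos (h0 y (hyU hz)) hz).ne'
  · rw [← hb1]
    exact integral_mono_ae hi hb (hle.mono fun y hy => (le_abs_self _).trans hy)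

end Average

/-! ### Quickest detection -/

section Detection

variable {A 𝒴 : Type*} [Fintype A] [DecidableEq A] [MeasurableSpace 𝒴]
variable {u : A → Fin 2 → ℝ} {p : ℝ} {B : Fin 2 → 𝒴 → ℝ} {π : Fin 2 → ℝ}

lemma measurable_predictiveDensity (hBm : ∀ x, Measurable (B x)) :
    Measurable (predictiveDensity p B π) := by
  unfold predictiveDensity
  fun_prop

lemma measurable_privateBelief (hBm : ∀ x, Measurable (B x)) :
    Measurable (privateBelief p B π) :=
  measurable_pi_lambda _ fun x =>
    ((hBm x).mul_const _).div (measurable_predictiveDensity hBm)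

lemma privateBelief_mem_stdSimplex (hp : p ∈ Set.Ico (0 : ℝ) 1) (hB0 : ∀ x y, 0 ≤ B x y)
    (hπ : π ∈ stdSimplex ℝ (Fin 2)) {y : 𝒴} (hy : 0 < predictiveDensity p B π y) :
    privateBelief p B π y ∈ stdSimplex ℝ (Fin 2) := by
  have hT : ∀ x, 0 ≤ ((transition p).transpose.mulVec π) x := fun x => by
    have h0 := hπ.1 0
    have h1 := hπ.1 1
    have h2 := hp.1
    have h3 : 0 ≤ 1 - p := by linarith [hp.2]
    fin_cases x <;> simp [transition, Matrix.mulVec, dotProduct, Fin.sum_univ_two] <;> positivity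
  refine ⟨fun x => div_nonneg (mul_nonneg (hB0 x y) (hT x)) hy.le, ?_⟩
  simp only [privateBelief, ← Finset.sum_div]
  exact div_self hy.ne'

/-- The two domains differ by faces of `D`, which are null; a density `Λ` thus only sees parameters
where the steady state exists for every belief. -/
lemma dissipativeDomain_ae_eq_paramDomain :
    dissipativeDomain =ᵐ[volume] paramDomain :=
  Measure.set_prod_ae_eq Ioc_ae_eq_Icc (Measure.set_prod_ae_eq (ae_eq_refl _) Ioo_ae_eq_Icc)

lemma measurableSet_dissipativeDomain : MeasurableSet dissipativeDomain :=
  measurableSet_Ioc.prod (measurableSet_Ici.prod measurableSet_Ioo)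

lemma continuousOn_klDivergence {Θ : Type*} [TopologicalSpace Θ] {s : Set Θ} {R S : Θ → A → ℝ}
    (hR : ∀ a, ContinuousOn (fun θ => R θ a) s) (hS : ∀ a, ContinuousOn (fun θ => S θ a) s)
    (hR0 : ∀ θ ∈ s, ∀ a, 0 < R θ a) (hS0 : ∀ θ ∈ s, ∀ a, 0 < S θ a) :
    ContinuousOn (fun θ => klDivergence (R θ) (S θ)) s :=
  continuousOn_finsetSum _ fun a _ => (hR a).mul
    (((hR a).div (hS a) fun θ hθ => (hS0 θ hθ a).ne').log fun θ hθ =>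
      (div_pos (hR0 θ hθ a) (hS0 θ hθ a)).ne')

variable [Nonempty A]

section Estimate

variable {Λ : ℝ × ℝ × ℝ → ℝ}

lemma aemeasurable_steadyAction_params (hu : ∀ a x, 0 < u a x) {η : Fin 2 → ℝ}
    (hη : η ∈ stdSimplex ℝ (Fin 2)) (a : A) :
    AEMeasurable (fun γ => steadyAction γ u η a) (volume.restrict dissipativeDomain) :=
  ((continuousOn_steadyAction hu a).comp (f := fun γ => (γ, η)) (by fun_prop)
    fun _ hγ => ⟨hη, dissipativeDomain_subset_steadyParams hu hη hγ⟩).aemeasurable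
      measurableSet_dissipativeDomain

lemma averaged_steadyAction_pos_le_one (hu : ∀ a x, 0 < u a x) {η : Fin 2 → ℝ}
    (hη : η ∈ stdSimplex ℝ (Fin 2)) (hΛ0 : ∀ γ ∈ paramDomain, 0 ≤ Λ γ)
    (hΛ1 : ∫ γ in paramDomain, Λ γ = 1) (a : A) :
    0 < ∫ γ in paramDomain, steadyAction γ u η a * Λ γ ∧
      ∫ γ in paramDomain, steadyAction γ u η a * Λ γ ≤ 1 := by
  rw [← Measure.restrict_congr_set dissipativeDomain_ae_eq_paramDomain] at hΛ1 ⊢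
  have hsub := dissipativeDomain_subset_steadyParams hu hη
  refine integral_mul_density_pos_le_one (U := dissipativeDomain) ?_ hΛ1
    measurableSet_dissipativeDomain
    ((ae_restrict_mem measurableSet_dissipativeDomain).mono fun γ hγ _ => hγ) ?_
    (fun γ hγ => steadyAction_pos hu hη (hsub hγ) a)
    fun γ hγ => steadyAction_le_one hu hη (hsub hγ) a
  · exact (ae_restrict_mem measurableSet_dissipativeDomain).mono fun γ hγ =>
      hΛ0 γ (dissipativeDomain_subset_paramDomain hγ)
  · rw [Measure.restrict_restrict measurableSet_dissipativeDomain, Set.inter_self]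
    exact aemeasurable_steadyAction_params hu hη a

lemma continuousOn_averaged_steadyAction (hu : ∀ a x, 0 < u a x)
    (hΛ1 : ∫ γ in paramDomain, Λ γ = 1) (a : A) :
    ContinuousOn (fun η => ∫ γ in paramDomain, steadyAction γ u η a * Λ γ)
      (stdSimplex ℝ (Fin 2)) := by
  rw [← Measure.restrict_congr_set dissipativeDomain_ae_eq_paramDomain] at hΛ1 ⊢
  have hΛ : Integrable Λ (volume.restrict dissipativeDomain) := by
    by_contra h
    rw [integral_undef h] at hΛ1
    exact zero_ne_one hΛ1
  intro η₀ hη₀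
  refine continuousWithinAt_of_dominated (bound := fun γ => ‖Λ γ‖) ?_ ?_ hΛ.norm ?_
  · filter_upwards [self_mem_nhdsWithin] with η hη
    exact (aemeasurable_steadyAction_params hu hη a).aestronglyMeasurable.mul hΛ.1
  · filter_upwards [self_mem_nhdsWithin] with η hη
    filter_upwards [ae_restrict_mem measurableSet_dissipativeDomain] with γ hγ
    have hγ' := dissipativeDomain_subset_steadyParams hu hη hγ
    rw [norm_mul, Real.norm_of_nonneg (steadyAction_pos hu hη hγ' a).le]
    exact mul_le_of_le_one_left (norm_nonneg _) (steadyAction_le_one hu hη hγ' a)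
  · filter_upwards [ae_restrict_mem measurableSet_dissipativeDomain] with γ hγ
    refine ContinuousWithinAt.mul ?_ continuousWithinAt_const
    exact (continuousOn_steadyAction hu a).comp (f := fun η => (γ, η)) (by fun_prop)
      (fun η hη => ⟨hη, dissipativeDomain_subset_steadyParams hu hη hγ⟩) η₀ hη₀

end Estimate

lemma continuousOn_inducedAction (hu : ∀ a x, 0 < u a x) (hp : p ∈ Set.Ico (0 : ℝ) 1)
    (hB0 : ∀ x y, 0 ≤ B x y) (hπ : π ∈ stdSimplex ℝ (Fin 2)) {y : 𝒴}
    (hy : 0 < predictiveDensity p B π y) (a : A) :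
    ContinuousOn (fun θ => inducedAction θ u p B π y a)
      (steadyParams u (privateBelief p B π y)) :=
  (continuousOn_steadyAction hu a).comp (f := fun θ => (θ, privateBelief p B π y)) (by fun_prop)
    fun _ hθ => ⟨privateBelief_mem_stdSimplex hp hB0 hπ hy, hθ⟩

lemma measurableSet_predictiveDensity_pos (hBm : ∀ x, Measurable (B x)) :
    MeasurableSet {y | 0 < predictiveDensity p B π y} :=
  measurableSet_lt measurable_const (measurable_predictiveDensity hBm)

lemma aemeasurable_inducedAction (ν : Measure 𝒴) (hu : ∀ a x, 0 < u a x)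
    (hp : p ∈ Set.Ico (0 : ℝ) 1) (hBm : ∀ x, Measurable (B x)) (hB0 : ∀ x y, 0 ≤ B x y)
    (hπ : π ∈ stdSimplex ℝ (Fin 2)) {θ : ℝ × ℝ × ℝ} (hθ : θ ∈ detectionParams u p B π) (a : A) :
    AEMeasurable (fun y => inducedAction θ u p B π y a)
      (ν.restrict {y | 0 < predictiveDensity p B π y}) :=
  aemeasurable_restrict_of_continuousOn_comp (f := fun y => (θ, privateBelief p B π y))
    (measurable_const.prodMk (measurable_privateBelief hBm))
    (measurableSet_predictiveDensity_pos hBm) (continuousOn_steadyAction hu a)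
    fun y hy => ⟨privateBelief_mem_stdSimplex hp hB0 hπ hy, hθ.2 y hy⟩

end Detection

end QuantumDecision

theorem corollary1 {A 𝒴 : Type*} [Fintype A] [DecidableEq A] [Nonempty A] [MeasurableSpace 𝒴]
    (ν : Measure 𝒴) (u : A → Fin 2 → ℝ) (hu : ∀ a x, 0 < u a x)
    (p : ℝ) (hp : p ∈ Set.Ico (0 : ℝ) 1)
    (B : Fin 2 → 𝒴 → ℝ) (hBm : ∀ x, Measurable (B x)) (hB0 : ∀ x y, 0 ≤ B x y)
    (hB1 : ∀ x, (∫ y, B x y ∂ν) = 1)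
    (π : Fin 2 → ℝ) (hπ : π ∈ stdSimplex ℝ (Fin 2)) :
    -- existence of the steady-state action distribution, and its continuity in `(α, lam, φ)`
    (∀ y, 0 < QuantumDecision.predictiveDensity p B π y →
      QuantumDecision.dissipativeDomain ⊆
        QuantumDecision.steadyParams u (QuantumDecision.privateBelief p B π y) ∧
      ∀ a, ContinuousOn (fun θ => QuantumDecision.inducedAction θ u p B π y a)
        (QuantumDecision.steadyParams u (QuantumDecision.privateBelief p B π y))) ∧
    QuantumDecision.dissipativeDomain ⊆ QuantumDecision.detectionParams u p B π ∧
    -- for every state in which the private belief is almost surely defined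
    ∀ x, (∀ᵐ y ∂ν, 0 < B x y → 0 < QuantumDecision.predictiveDensity p B π y) →
      -- continuity of the action likelihoods
      (∀ a, ContinuousOn (fun θ => QuantumDecision.actionLikelihood ν θ u p B π x a)
        (QuantumDecision.detectionParams u p B π)) ∧
      -- continuity of the divergence in the true parameters and in a point estimate
      (∀ θ ∈ QuantumDecision.detectionParams u p B π, ∀ a,
        0 < QuantumDecision.actionLikelihood ν θ u p B π x a) ∧
      ContinuousOn
        (fun q : (ℝ × ℝ × ℝ) × (ℝ × ℝ × ℝ) => QuantumDecision.klDivergence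
          (QuantumDecision.actionLikelihood ν q.1 u p B π x)
          (QuantumDecision.actionLikelihood ν q.2 u p B π x))
        (QuantumDecision.detectionParams u p B π ×ˢ QuantumDecision.detectionParams u p B π) ∧
      -- continuity of the divergence in the true parameters for a probabilistic estimate
      ∀ Λ : ℝ × ℝ × ℝ → ℝ, (∀ γ ∈ QuantumDecision.paramDomain, 0 ≤ Λ γ) →
        (∫ γ in QuantumDecision.paramDomain, Λ γ) = 1 →
        (∀ a, 0 < QuantumDecision.estimatedLikelihood ν Λ u p B π x a) ∧
        ContinuousOn
          (fun θ => QuantumDecision.klDivergence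
            (QuantumDecision.actionLikelihood ν θ u p B π x)
            (QuantumDecision.estimatedLikelihood ν Λ u p B π x))
          (QuantumDecision.detectionParams u p B π) := by

  have hmem : ∀ y, 0 < QuantumDecision.predictiveDensity p B π y →
      QuantumDecision.privateBelief p B π y ∈ stdSimplex ℝ (Fin 2) := fun y hy =>
    QuantumDecision.privateBelief_mem_stdSimplex hp hB0 hπ hy
  refine ⟨fun y hy => ⟨QuantumDecision.dissipativeDomain_subset_steadyParams hu (hmem y hy),
    QuantumDecision.continuousOn_inducedAction hu hp hB0 hπ hy⟩,
    fun θ hθ => ⟨QuantumDecision.dissipativeDomain_subset_paramDomain hθ, fun y hy =>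
      QuantumDecision.dissipativeDomain_subset_steadyParams hu (hmem y hy) hθ⟩, fun x hx => ?_⟩
  have hU := QuantumDecision.measurableSet_predictiveDensity_pos (p := p) (π := π) hBm
  have hB0' : 0 ≤ᵐ[ν] B x := Eventually.of_forall (hB0 x)
  have hBi : Integrable (B x) ν := by
    by_contra h
    exact zero_ne_one ((integral_undef h).symm.trans (hB1 x))
  have hmeas : ∀ θ ∈ QuantumDecision.detectionParams u p B π, ∀ a,
      AEMeasurable (fun y => QuantumDecision.inducedAction θ u p B π y a)
        (ν.restrict {y | 0 < QuantumDecision.predictiveDensity p B π y}) := fun θ hθ a =>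
    QuantumDecision.aemeasurable_inducedAction ν hu hp hBm hB0 hπ hθ a
  have hpos : ∀ θ ∈ QuantumDecision.detectionParams u p B π, ∀ a,
      ∀ y ∈ {y | 0 < QuantumDecision.predictiveDensity p B π y},
        0 < QuantumDecision.inducedAction θ u p B π y a := fun θ hθ a y hy =>
    QuantumDecision.steadyAction_pos hu (hmem y hy) (hθ.2 y hy) a
  have hle : ∀ θ ∈ QuantumDecision.detectionParams u p B π, ∀ a,
      ∀ y ∈ {y | 0 < QuantumDecision.predictiveDensity p B π y},
        QuantumDecision.inducedAction θ u p B π y a ≤ 1 := fun θ hθ a y hy =>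
    QuantumDecision.steadyAction_le_one hu (hmem y hy) (hθ.2 y hy) a
  have hRpos : ∀ θ ∈ QuantumDecision.detectionParams u p B π, ∀ a,
      0 < QuantumDecision.actionLikelihood ν θ u p B π x a := fun θ hθ a =>
    (QuantumDecision.integral_mul_density_pos_le_one hB0' (hB1 x) hU hx (hmeas θ hθ a)
      (hpos θ hθ a) (hle θ hθ a)).1
  have hRcont : ∀ a, ContinuousOn
      (fun θ => QuantumDecision.actionLikelihood ν θ u p B π x a)
      (QuantumDecision.detectionParams u p B π) := by
    intro a θ₀ hθ₀
    refine continuousWithinAt_of_dominated (bound := B x) ?_ ?_ hBi ?_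
    · filter_upwards [self_mem_nhdsWithin] with θ hθ
      exact QuantumDecision.aestronglyMeasurable_mul_density hBi hB0' hU hx (hmeas θ hθ a)
    · filter_upwards [self_mem_nhdsWithin] with θ hθ
      exact QuantumDecision.norm_mul_density_le hB0' hx (hpos θ hθ a) (hle θ hθ a)
    · filter_upwards [hB0', hx] with y hy0 hy
      -- Where `B x y = 0` the private belief may be undefined, but the integrand is identically
      -- zero in `θ`.
      rcases hy0.eq_or_lt with hz | hz
      · simp only [← hz, Pi.zero_apply, mul_zero]
        exact continuousWithinAt_const
      · refine ContinuousWithinAt.mul ?_ continuousWithinAt_const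
        exact (QuantumDecision.continuousOn_inducedAction hu hp hB0 hπ (hy hz) a).mono
          (fun θ hθ => hθ.2 y (hy hz)) θ₀ hθ₀
  refine ⟨hRcont, hRpos, ?_, fun Λ hΛ0 hΛ1 => ?_⟩
  · exact QuantumDecision.continuousOn_klDivergence
      (fun a => (hRcont a).comp continuousOn_fst fun q hq => hq.1)
      (fun a => (hRcont a).comp continuousOn_snd fun q hq => hq.2)
      (fun q hq => hRpos _ hq.1) (fun q hq => hRpos _ hq.2)
  -- The inner average over `Λ` is continuous in the belief, hence measurable in `y`, and lies in
  -- `(0,1]`; the averaging lemma then applies a second time.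
  · have hest : ∀ a, 0 < QuantumDecision.estimatedLikelihood ν Λ u p B π x a := fun a =>
      (QuantumDecision.integral_mul_density_pos_le_one hB0' (hB1 x) hU hx
        (QuantumDecision.aemeasurable_restrict_of_continuousOn_comp
          (QuantumDecision.measurable_privateBelief hBm) hU
          (QuantumDecision.continuousOn_averaged_steadyAction hu hΛ1 a) hmem)
        (fun y hy => (QuantumDecision.averaged_steadyAction_pos_le_one hu (hmem y hy)
          hΛ0 hΛ1 a).1)
        fun y hy => (QuantumDecision.averaged_steadyAction_pos_le_one hu (hmem y hy)
          hΛ0 hΛ1 a).2).1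
    exact ⟨hest, QuantumDecision.continuousOn_klDivergence hRcont
      (fun a => continuousOn_const) hRpos fun _ _ => hest⟩
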